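/- Let $\Omega\subset\mathbb R^3$ be a bounded domain with a Liapunov boundary (locally, after a rigid motion, $\Omega$ is the region below the graph of a $C^{1,\alpha}$ function, for some $0<\alpha\le 1$), let $1<p<\infty$ and $1/p+1/q=1$, and let $\omega,\epsilon,\mu\in\mathbb C\setminus\{0\}$. Let $\lambda\in\mathbb C$ satisfy $\lambda^2=\omega^2\epsilon\mu$ and $\operatorname{Im}\lambda\ge 0$. Let $\vec j\in W^{p,\operatorname{div}}(\Omega)$, i.e. $\vec j\in L^p(\Omega;\mathbb C^3)$ with weak divergence $\operatorname{div}\vec j\in L^p(\Omega)$, and put $\rho=\frac1{i\omega}\operatorname{div}\vec j$. Consider the time-harmonic Maxwell system in $\Omega$ $$\operatorname{curl}\vec H=-i\omega\epsilon\vec E+\vec j,\quad \operatorname{div}\vec H=0,\quad \operatorname{curl}\vec E=i\omega\mu\vec H,\quad \operatorname{div}\vec E=\rho/\epsilon .\qquad (*)$$ Let $\theta(\vec x)=-\frac{e^{i\lambda|\vec x|}}{4\pi|\vec x|}$ and, for $\vec x\in\Omega$, $$\vec T_{2,\pm\lambda}[\vec j](\vec x)=\int_\Omega\Big[\pm\lambda\,\theta(\vec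 x-\vec y)\,\vec j(\vec y)-(\operatorname{grad}\theta)(\vec x-\vec y)\times\vec j(\vec y)\Big]\,d\vec y .$$ For $\kappa\in\{\lambda,-\lambda\}$, a force-free field for the wave number $\kappa$ is a field $\vec u\in C^1(\Omega;\mathbb C^3)$ with $\operatorname{div}\vec u=0$ and $\operatorname{curl}\vec u+\kappa\vec u=0$ in $\Omega$. Then the integrals defining $\vec T_{2,\pm\lambda}[\vec j](\vec x)$ converge absolutely for almost every $\vec x\in\Omega$, the fields $\vec T_{2,\pm\lambda}[\vec j]$ belong to $L^p_{\rm loc}(\Omega)$, and the weak curls $\operatorname{curl}(\vec T_{2,\lambda}\pm\vec T_{2,-\lambda})[\vec j]$ exist in $\Omega$ and belong to $L^p_{\rm loc}(\Omega)$. Moreover, consider the representation, almost everywhere in $\Omega$, $$\vec E=\frac1{2i\omega\epsilon}\Big(2\vec j-\operatorname{curl}(\vec T_{2,\lambda}+\vec T_{2,-\lambda})[\vec j]\Big)+\frac1{2i\omega\epsilon}(\vec u-\vec v),$$ $$\vec H=-\frac1{2\lambda}\operatorname{curl}(\vec T_{2,\lambda}-\vec T_{2,-\lambda})[\vec j]+\frac1{2\lambda}(\vec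 u+\vec v).\qquad (**)$$ 1. A pair $(\vec E,\vec H)$ of complex vector fields on $\Omega$ belongs to $L^p_{\rm loc}(\Omega)$ and solves $(*)$ weakly (tested against all functions in $C_c^\infty(\Omega)$) if and only if $(**)$ holds for some force-free fields $\vec u$ and $\vec v$ for the wave numbers $\lambda$ and $-\lambda$, respectively. In particular, $(**)$ gives a weak solution for arbitrary such $\vec u,\vec v$. 2. A pair $(\vec E,\vec H)$ of fields in $L^p(\Omega)$ solves $(*)$ weakly, tested against all functions in $W^{1,q}_0(\Omega)$, if and only if $(**)$ holds for some force-free fields $\vec u$ and $\vec v$ for the wave numbers $\lambda$ and $-\lambda$, respectively. -/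

import Mathlib

open MeasureTheory Filter Topology
open scoped ENNReal NNReal

noncomputable section

namespace MaxwellWeak

/-- Real Euclidean three-space. -/
abbrev R3 := EuclideanSpace ℝ (Fin 3)

/-- The values of complex vector fields (purely vectorial biquaternions). -/
abbrev C3 := Fin 3 → ℂ

/-! ### Domains with a Liapunov boundary -/

/-- `Ω` is a bounded domain (nonempty, open, connected) whose boundary is a Liapunov surface:
for some `α ∈ (0, 1]`, near every boundary point and after a rigid motion, `Ω` is the region
below the graph of a `C¹` function of two variables with `α`-Hölder continuous derivative. -/
structure IsLiapunovDomain (Ω : Set R3) : Prop where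
  isOpen : IsOpen Ω
  isConnected : IsConnected Ω
  isBounded : Bornology.IsBounded Ω
  boundary : ∃ α : ℝ≥0, 0 < α ∧ α ≤ 1 ∧ ∀ x₀ ∈ frontier Ω,
    ∃ (R : R3 ≃ₗᵢ[ℝ] R3) (r h : ℝ) (C : ℝ≥0) (f : EuclideanSpace ℝ (Fin 2) → ℝ),
      0 < r ∧ 0 < h ∧ f 0 = 0 ∧ ContDiffOn ℝ 1 f (Metric.ball 0 r) ∧
      HolderOnWith C α (fderiv ℝ f) (Metric.ball 0 r) ∧
      ∀ y : R3, !₂[y 0, y 1] ∈ Metric.ball (0 : EuclideanSpace ℝ (Fin 2)) r → |y 2| < h →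
        (x₀ + R y ∈ Ω ↔ y 2 < f !₂[y 0, y 1])

/-! ### Classical vector calculus and force-free fields -/

/-- The gradient `(∂₁φ, ∂₂φ, ∂₃φ)` of a scalar function. -/
def grad (φ : R3 → ℂ) (x : R3) : C3 :=
  fun i => fderiv ℝ φ x (EuclideanSpace.single i 1)

/-- The partial derivative `∂ᵢ uₖ` of a vector field. -/
def partialDeriv (u : R3 → C3) (i k : Fin 3) (x : R3) : ℂ :=
  fderiv ℝ u x (EuclideanSpace.single i 1) k

/-- The classical divergence. -/
def divergence (u : R3 → C3) (x : R3) : ℂ :=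
  ∑ i, partialDeriv u i i x

/-- The classical curl. -/
def curl (u : R3 → C3) (x : R3) : C3 :=
  ![partialDeriv u 1 2 x - partialDeriv u 2 1 x,
    partialDeriv u 2 0 x - partialDeriv u 0 2 x,
    partialDeriv u 0 1 x - partialDeriv u 1 0 x]

/-- Force-free fields for the wave number `κ`: purely vectorial `C¹` solutions in `Ω` of
`(D + κ) u = 0`, whose scalar part is `-div u` and whose vector part is `curl u + κ u`. -/
structure IsForceFree (Ω : Set R3) (κ : ℂ) (u : R3 → C3) : Prop where
  contDiffOn : ContDiffOn ℝ 1 u Ω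
  div_eq : ∀ x ∈ Ω, divergence u x = 0
  curl_eq : ∀ x ∈ Ω, curl u x + κ • u x = 0

/-! ### Test functions and weak derivatives -/

/-- Pairs `(φ, grad φ)` with `φ` a smooth function compactly supported in `Ω`. -/
def smoothTests (Ω : Set R3) : Set ((R3 → ℂ) × (R3 → C3)) :=
  {t | ContDiff ℝ (⊤ : ℕ∞) t.1 ∧ HasCompactSupport t.1 ∧ tsupport t.1 ⊆ Ω ∧ t.2 = grad t.1}

/-- Pairs `(v, grad v)` with `v ∈ W₀^{1,q}(Ω)`, the closure of the smooth compactly supported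
functions in the norm of `W^{1,q}(Ω)`. -/
def sobolevTests (Ω : Set R3) (q : ℝ≥0∞) : Set ((R3 → ℂ) × (R3 → C3)) :=
  {t | MemLp t.1 q (volume.restrict Ω) ∧ MemLp t.2 q (volume.restrict Ω) ∧
    ∃ φ : ℕ → R3 → ℂ, (∀ n, (φ n, grad (φ n)) ∈ smoothTests Ω) ∧
      Tendsto (fun n => eLpNorm (φ n - t.1) q (volume.restrict Ω)) atTop (𝓝 0) ∧
      Tendsto (fun n => eLpNorm (grad (φ n) - t.2) q (volume.restrict Ω)) atTop (𝓝 0)}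

/-- `curl F = G` in `Ω` weakly, against all test pairs `(v, grad v)` in `T`. -/
def WeakCurl (T : Set ((R3 → ℂ) × (R3 → C3))) (Ω : Set R3) (F G : R3 → C3) : Prop :=
  ∀ t ∈ T, ∫ x in Ω, t.1 x • G x = -∫ x in Ω, crossProduct (t.2 x) (F x)

/-- `div F = d` in `Ω` weakly, against all test pairs `(v, grad v)` in `T`. -/
def WeakDiv (T : Set ((R3 → ℂ) × (R3 → C3))) (Ω : Set R3) (F : R3 → C3) (d : R3 → ℂ) : Prop :=
  ∀ t ∈ T, ∫ x in Ω, t.1 x * d x = -∫ x in Ω, t.2 x ⬝ᵥ F x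

/-- `F ∈ L^p_loc(Ω)`. -/
def MemLpLoc (F : R3 → C3) (p : ℝ≥0∞) (Ω : Set R3) : Prop :=
  ∀ K ⊆ Ω, IsCompact K → MemLp F p (volume.restrict K)

/-- `W^{p,div}(Ω)`: fields in `L^p(Ω)` whose weak divergence `d` is in `L^p(Ω)`. -/
def MemWDiv (Ω : Set R3) (p : ℝ≥0∞) (F : R3 → C3) (d : R3 → ℂ) : Prop :=
  MemLp F p (volume.restrict Ω) ∧ MemLp d p (volume.restrict Ω) ∧
    WeakDiv (smoothTests Ω) Ω F d

/-! ### The Teodorescu component operators -/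

/-- The fundamental solution `θ(x) = -exp(iλ|x|) / (4π|x|)` of `Δ + λ²`. -/
def theta (lam : ℂ) (x : R3) : ℂ :=
  -Complex.exp (Complex.I * lam * ‖x‖) / (4 * Real.pi * ‖x‖)

/-- The vector part `-grad θ(x) = θ(x) (x/|x|² - iλ x/|x|)` of both kernels `E_{±λ}`. -/
def vecE (lam : ℂ) (x : R3) : C3 :=
  fun k => theta lam x * ((x k : ℂ) / (‖x‖ : ℂ) ^ 2 - Complex.I * lam * (x k : ℂ) / (‖x‖ : ℂ))

/-- The integrand `Sc E_κ(x-y) w(y) + Vec E_κ(x-y) × w(y)` of `T_{2,κ}[w](x)`, for `κ = ±λ`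
(both signs use the same `θ`), where `Sc E_κ = κ θ`. -/
def teodorescuIntegrand (lam κ : ℂ) (w : R3 → C3) (x y : R3) : C3 :=
  (κ * theta lam (x - y)) • w y + crossProduct (vecE lam (x - y)) (w y)

/-- The operator `T_{2,κ}` over `Ω`, for `κ = ±λ`. -/
def teodorescuTwo (Ω : Set R3) (lam κ : ℂ) (w : R3 → C3) (x : R3) : C3 :=
  ∫ y in Ω, teodorescuIntegrand lam κ w x y

/-! ### The time-harmonic Maxwell system -/

/-- The system `curl H = -iωε E + j`, `div H = 0`, `curl E = iωμ H`, `div E = ρ/ε` in `Ω`,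
in the weak sense against the test pairs in `T`. -/
structure WeakMaxwell (T : Set ((R3 → ℂ) × (R3 → C3))) (Ω : Set R3) (ω ε μ : ℂ)
    (ρ : R3 → ℂ) (j E H : R3 → C3) : Prop where
  curl_H : WeakCurl T Ω H (fun x => -(Complex.I * ω * ε) • E x + j x)
  div_H : WeakDiv T Ω H (fun _ => 0)
  curl_E : WeakCurl T Ω E (fun x => (Complex.I * ω * μ) • H x)
  div_E : WeakDiv T Ω E (fun x => ρ x / ε)

/-- The representation of `(E, H)` (almost everywhere in `Ω`) by `j`, by
`S = curl (T_{2,λ} + T_{2,-λ})[j]`, `Δ = curl (T_{2,λ} - T_{2,-λ})[j]` and by some force-free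
fields `u`, `v` for the wave numbers `λ`, `-λ`. -/
def HasRepresentation (Ω : Set R3) (ω ε lam : ℂ) (j S Δ E H : R3 → C3) : Prop :=
  ∃ u v : R3 → C3, IsForceFree Ω lam u ∧ IsForceFree Ω (-lam) v ∧
    (∀ᵐ x ∂(volume.restrict Ω),
      E x = (1 / (2 * Complex.I * ω * ε)) • ((2 : ℂ) • j x - S x)
        + (1 / (2 * Complex.I * ω * ε)) • (u x - v x)) ∧
    (∀ᵐ x ∂(volume.restrict Ω),
      H x = -((1 / (2 * lam)) • Δ x) + (1 / (2 * lam)) • (u x + v x))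

end MaxwellWeak

end

noncomputable section

namespace MaxwellWeak

/-! ### Partial derivatives, test functions and the distributional pairing -/

/-! Put a = iωε and b = iωμ, so that ab = -λ². The curl equations read curl H = -aE + j and curl E =
bH, and they are diagonalised by two combinations: (curl + λ)(aE + λH) = λj and (curl - λ)(λH - aE)
= λj. The divergence equations follow from div curl = 0 (`weakMaxwell_smoothTests_iff`). Hence one
particular solution of (curl + κ)w = κj for each κ = ±λ, together with a description of the
homogeneous solutions, gives everything; u and v are the differences
(`isCurl_pair_iff_representation`).

Particular solution: let A = θ * j over Ω. Then T_κ[j] = κA - curl A, so S_κ = curl T_κ[j] = κ curl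
A - grad div A + ΔA, with ΔA = j - λ²A in Ω. As κ² = λ², this says j - S_κ = κ T_κ[j] + grad div A.
A gradient has no curl, so curl (j - S_κ) = κ S_κ, i.e. (curl + κ)(j - S_κ) = κj
(`isCurl_teodorescu`, `isCurl_source_sub`). Young's inequality puts A and curl A in L^p. No singular
integrals are needed for grad div A: since div j is in L^p, it is locally grad θ * div j with
truncated θ, plus a convolution of j with a smooth kernel (`exists_grad_div`).

Homogeneous solutions: if curl w + κw = 0 weakly, then w is a multiple of a curl, hence
divergence-free, so its components solve the Helmholtz equation. Weyl's lemma (`exists_smooth_rep`)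
makes them smooth, and w is a.e. a force-free field (`exists_isForceFree`).

Both halves use compactly supported parametrices ηθ (`exists_isParametrix`), integrable kernels
inverting Δ + λ² up to a smooth kernel. A radius above the diameter of Ω makes the inversion exact
inside Ω; a small radius keeps convolved test functions inside Ω. That θ is a fundamental solution
(`pair_theta_helm`) comes from replacing |x| by √(|x|² + e²) and letting e → 0.

For fields in L^p, Hölder's inequality and density make the two classes of test functions equivalent
(`weakMaxwell_sobolevTests_iff`). -/

/-- The partial derivative `∂ᵢ φ` of a scalar function. -/
def pd (i : Fin 3) (φ : R3 → ℂ) (x : R3) : ℂ :=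
  fderiv ℝ φ x (EuclideanSpace.single i 1)

/-- `φ` is a smooth function compactly supported in `Ω`. -/
structure IsTest (Ω : Set R3) (φ : R3 → ℂ) : Prop where
  smooth : ContDiff ℝ (⊤ : ℕ∞) φ
  compact : HasCompactSupport φ
  subset : tsupport φ ⊆ Ω

/-- The pairing `∫ φ f` of a function `f` with a test function `φ`. -/
def pair (f φ : R3 → ℂ) : ℂ := ∫ x, φ x * f x

lemma pd_add {φ ψ : R3 → ℂ} (i : Fin 3) (hφ : Differentiable ℝ φ) (hψ : Differentiable ℝ ψ) :
    pd i (fun x => φ x + ψ x) = fun x => pd i φ x + pd i ψ x := by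
  funext x
  simp [pd, fderiv_fun_add (hφ x) (hψ x)]

lemma pd_mul {φ ψ : R3 → ℂ} (i : Fin 3) (hφ : Differentiable ℝ φ) (hψ : Differentiable ℝ ψ) :
    pd i (fun x => φ x * ψ x) = fun x => pd i φ x * ψ x + φ x * pd i ψ x := by
  funext x
  simp [pd, fderiv_fun_mul (hφ x) (hψ x)]
  ring

lemma contDiff_pd {φ : R3 → ℂ} (i : Fin 3) (hφ : ContDiff ℝ (⊤ : ℕ∞) φ) :
    ContDiff ℝ (⊤ : ℕ∞) (pd i φ) :=
  (hφ.fderiv_right (m := (⊤ : ℕ∞)) le_rfl).clm_apply contDiff_const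

lemma pd_comm {φ : R3 → ℂ} (i k : Fin 3) (hφ : ContDiff ℝ (⊤ : ℕ∞) φ) :
    pd i (pd k φ) = pd k (pd i φ) := by
  funext x
  have hd : DifferentiableAt ℝ (fderiv ℝ φ) x :=
    ((hφ.fderiv_right (m := (⊤ : ℕ∞)) le_rfl).differentiable (by simp)) x
  have key : ∀ a b : Fin 3, pd a (pd b φ) x =
      fderiv ℝ (fderiv ℝ φ) x (EuclideanSpace.single a 1) (EuclideanSpace.single b 1) := by
    intro a b
    unfold pd
    rw [fderiv_clm_apply hd (differentiableAt_const _)]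
    simp
  rw [key, key]
  have hs : IsSymmSndFDerivAt ℝ φ x := hφ.contDiffAt.isSymmSndFDerivAt (by
    simpa using WithTop.coe_le_coe.2 (le_top : (2 : ℕ∞) ≤ ⊤))
  exact hs _ _

lemma tsupport_pd_subset (i : Fin 3) (φ : R3 → ℂ) : tsupport (pd i φ) ⊆ tsupport φ :=
  tsupport_fderiv_apply_subset ℝ _

namespace IsTest

variable {Ω : Set R3} {φ ψ : R3 → ℂ}

lemma differentiable (h : IsTest Ω φ) : Differentiable ℝ φ := h.smooth.differentiable (by simp)

lemma continuous (h : IsTest Ω φ) : Continuous φ := h.smooth.continuous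

lemma mono {U : Set R3} (h : IsTest Ω φ) (hU : Ω ⊆ U) : IsTest U φ :=
  ⟨h.smooth, h.compact, h.subset.trans hU⟩

lemma pd (h : IsTest Ω φ) (i : Fin 3) : IsTest Ω (pd i φ) :=
  ⟨contDiff_pd i h.smooth, h.compact.mono' ((subset_tsupport _).trans (tsupport_pd_subset i φ)),
    (tsupport_pd_subset i φ).trans h.subset⟩

lemma mul_left (h : IsTest Ω φ) (hψ : ContDiff ℝ (⊤ : ℕ∞) ψ) : IsTest Ω (fun x => ψ x * φ x) :=
  ⟨hψ.mul h.smooth, h.compact.mul_left, (tsupport_mul_subset_right).trans h.subset⟩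

lemma const_mul (h : IsTest Ω φ) (c : ℂ) : IsTest Ω (fun x => c * φ x) :=
  h.mul_left contDiff_const

lemma add (h : IsTest Ω φ) (h' : IsTest Ω ψ) : IsTest Ω (fun x => φ x + ψ x) :=
  ⟨h.smooth.add h'.smooth, h.compact.add h'.compact,
    (tsupport_add φ ψ).trans (Set.union_subset h.subset h'.subset)⟩

lemma integrable_mul (h : IsTest Ω φ) {f : R3 → ℂ} (hf : LocallyIntegrableOn f Ω) :
    Integrable (fun x => φ x * f x) := by
  have h1 : IntegrableOn f (tsupport φ) :=
    hf.integrableOn_compact_subset h.subset h.compact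
  have h2 : IntegrableOn (fun x => φ x * f x) (tsupport φ) :=
    h1.continuousOn_mul h.continuous.continuousOn h.compact
  refine (integrableOn_iff_integrable_of_support_subset ?_).1 h2
  intro x hx
  by_contra hx'
  exact hx (by simp [image_eq_zero_of_notMem_tsupport hx'])

lemma integrable (h : IsTest Ω φ) : Integrable φ :=
  h.continuous.integrable_of_hasCompactSupport h.compact

lemma eq_zero (h : IsTest Ω φ) {x : R3} (hx : x ∉ Ω) : φ x = 0 :=
  image_eq_zero_of_notMem_tsupport fun hx' => hx (h.subset hx')

lemma setIntegral_eq (h : IsTest Ω φ) (f : R3 → ℂ) : ∫ x in Ω, φ x * f x = pair f φ :=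
  setIntegral_eq_integral_of_forall_compl_eq_zero fun x hx => by simp [h.eq_zero hx]

lemma exists_bound (h : IsTest Ω φ) : ∃ C, ∀ x, ‖φ x‖ ≤ C :=
  h.continuous.bounded_above_of_compact_support h.compact

end IsTest

section pair

variable {Ω : Set R3} {f g φ ψ : R3 → ℂ}

lemma pair_add_left (hφ : IsTest Ω φ) (hf : LocallyIntegrableOn f Ω)
    (hg : LocallyIntegrableOn g Ω) : pair (fun x => f x + g x) φ = pair f φ + pair g φ := by
  simp only [pair, mul_add]
  exact integral_add (hφ.integrable_mul hf) (hφ.integrable_mul hg)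

lemma pair_sub_left (hφ : IsTest Ω φ) (hf : LocallyIntegrableOn f Ω)
    (hg : LocallyIntegrableOn g Ω) : pair (fun x => f x - g x) φ = pair f φ - pair g φ := by
  simp only [pair, mul_sub]
  exact integral_sub (hφ.integrable_mul hf) (hφ.integrable_mul hg)

lemma pair_const_mul_left (c : ℂ) : pair (fun x => c * f x) φ = c * pair f φ := by
  simp only [pair, mul_left_comm _ c, integral_const_mul]

lemma pair_add_right (hφ : IsTest Ω φ) (hψ : IsTest Ω ψ) (hf : LocallyIntegrableOn f Ω) :
    pair f (fun x => φ x + ψ x) = pair f φ + pair f ψ := by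
  simp only [pair, add_mul]
  exact integral_add (hφ.integrable_mul hf) (hψ.integrable_mul hf)

lemma pair_const_mul_right (c : ℂ) : pair f (fun x => c * φ x) = c * pair f φ := by
  simp only [pair, mul_assoc, integral_const_mul]

lemma pair_congr (hφ : IsTest Ω φ) (h : f =ᵐ[volume.restrict Ω] g) :
    pair f φ = pair g φ := by
  rw [← hφ.setIntegral_eq f, ← hφ.setIntegral_eq g]
  exact integral_congr_ae (h.mono fun x hx => by simp [hx])

/-- Integration by parts against a test function. -/
lemma pair_pd (hΩ : IsOpen Ω) (hφ : IsTest Ω φ) (hf : ContDiffOn ℝ 1 f Ω) (i : Fin 3) :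
    pair (pd i f) φ = -pair f (pd i φ) := by
  have hc : ContinuousOn (pd i f) Ω := by
    have := hf.continuousOn_fderiv_of_isOpen hΩ le_rfl
    exact this.clm_apply continuousOn_const
  have h1 : LocallyIntegrableOn f Ω := hf.continuousOn.locallyIntegrableOn hΩ.measurableSet
  have h2 : LocallyIntegrableOn (pd i f) Ω := hc.locallyIntegrableOn hΩ.measurableSet
  -- `f` has to be differentiable only on the support of `φ`, which lies in `Ω`; its values
  -- elsewhere do not matter.
  refine integral_mul_fderiv_eq_neg_fderiv_mul_of_integrable
    ((hφ.pd i).integrable_mul h1) (hφ.integrable_mul h2) (hφ.integrable_mul h1)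
    (fun x _ => hφ.differentiable x) fun x hx => ?_
  exact (hf.differentiableOn one_ne_zero).differentiableAt (hΩ.mem_nhds (hφ.subset hx))

/-- Two locally integrable functions that agree as distributions in `Ω` agree there almost
everywhere. -/
lemma ae_eq_of_pair_eq (hΩ : IsOpen Ω) (hf : LocallyIntegrableOn f Ω)
    (hg : LocallyIntegrableOn g Ω) (h : ∀ φ, IsTest Ω φ → pair f φ = pair g φ) :
    f =ᵐ[volume.restrict Ω] g := by
  have := hΩ.ae_eq_zero_of_integral_contDiff_smul_eq_zero (hf.sub hg) (fun η hη hc hs => ?_)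
  · rw [EventuallyEq, ae_restrict_iff' hΩ.measurableSet]
    filter_upwards [this] with x hx hxΩ
    exact sub_eq_zero.1 (hx hxΩ)
  -- The criterion tests with real-valued `η`, which is viewed here as a complex test function.
  · have ht : IsTest Ω (fun x => (η x : ℂ)) := by
      have hsupp : tsupport (fun x => (η x : ℂ)) ⊆ tsupport η :=
        closure_mono fun x hx => by simpa using hx
      exact ⟨Complex.ofRealCLM.contDiff.comp hη, hc.comp_left (g := Complex.ofReal) rfl,
        hsupp.trans hs⟩
    have := pair_sub_left ht hf hg
    rw [h _ ht, sub_self] at this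
    simpa [pair] using this

end pair

section

/-! ### The fundamental solution of the Helmholtz operator -/

/-- The regularized radius `√(|x|² + e²)`. -/
def regRadius (e : ℝ) (x : R3) : ℝ := Real.sqrt (‖x‖ ^ 2 + e ^ 2)

section regRadius

variable {e : ℝ}

lemma regRadius_pos (he : 0 < e) (x : R3) : 0 < regRadius e x := Real.sqrt_pos.2 (by positivity)

lemma regRadius_sq (e : ℝ) (x : R3) : regRadius e x ^ 2 = ‖x‖ ^ 2 + e ^ 2 :=
  Real.sq_sqrt (by positivity)

lemma norm_le_regRadius (e : ℝ) (x : R3) : ‖x‖ ≤ regRadius e x :=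
  Real.le_sqrt_of_sq_le (by nlinarith [sq_nonneg e])

lemma contDiff_regRadius (he : 0 < e) {n : WithTop ℕ∞} : ContDiff ℝ n (regRadius e) :=
  ((contDiff_norm_sq ℝ).add contDiff_const).sqrt fun x => by positivity

lemma tendsto_regRadius (x : R3) : Tendsto (fun e => regRadius e x) (𝓝[>] 0) (𝓝 ‖x‖) := by
  have : Continuous (fun e => regRadius e x) := by unfold regRadius; fun_prop
  have h := (this.tendsto 0).mono_left (nhdsWithin_le_nhds (s := Set.Ioi 0))
  simpa [regRadius] using h

/-- Chain rule, with ∂ᵢs = xᵢ/s for s² = |x|² + e². -/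
lemma hasFDerivAt_comp_regRadius (he : 0 < e) {F : ℝ → ℂ} {F' : ℂ} {x : R3}
    (hF : HasDerivAt F F' (regRadius e x)) :
    ∃ L : R3 →L[ℝ] ℂ, HasFDerivAt (fun y => F (regRadius e y)) L x ∧
      ∀ i, L (EuclideanSpace.single i 1) = (x i : ℂ) / (regRadius e x : ℂ) * F' := by
  have h1 := (((hasStrictFDerivAt_norm_sq x).hasFDerivAt.add_const (e ^ 2)).sqrt
    (by positivity : ‖x‖ ^ 2 + e ^ 2 ≠ 0))
  refine ⟨_, hF.hasFDerivAt.comp x h1, fun i => ?_⟩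
  simp [EuclideanSpace.inner_single_right, regRadius]
  ring

end regRadius

/-- The regularization of `theta`, with `|x|` replaced by `√(|x|² + e²)`. -/
def thetaReg (lam : ℂ) (e : ℝ) (x : R3) : ℂ :=
  -Complex.exp (Complex.I * lam * regRadius e x) / (4 * Real.pi * regRadius e x)

/-- The radial factor `m` with `∂ᵢ thetaReg = xᵢ m`, as a function of the radius. -/
def gradFactor (lam : ℂ) (s : ℝ) : ℂ :=
  -(1 / (4 * Real.pi)) * Complex.exp (Complex.I * lam * s) *
    (Complex.I * lam / (s : ℂ) ^ 2 - 1 / (s : ℂ) ^ 3)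

/-- The radial profile of `(Δ + λ²) thetaReg`. -/
def helmFactor (lam : ℂ) (e s : ℝ) : ℂ :=
  e ^ 2 / (4 * Real.pi) * Complex.exp (Complex.I * lam * s) *
    (3 / (s : ℂ) ^ 5 - 3 * Complex.I * lam / (s : ℂ) ^ 4 - lam ^ 2 / (s : ℂ) ^ 3)

lemma hasDerivAt_cexp_mul_ofReal (c : ℂ) (s : ℝ) :
    HasDerivAt (fun t : ℝ => Complex.exp (c * t)) (Complex.exp (c * s) * c) s := by
  have h := ((hasDerivAt_id (s : ℂ)).const_mul c).cexp.comp_ofReal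
  simpa using h

lemma norm_cexp_le_one {lam : ℂ} (hlam : 0 ≤ lam.im) {s : ℝ} (hs : 0 ≤ s) :
    ‖Complex.exp (Complex.I * lam * s)‖ ≤ 1 := by
  rw [Complex.norm_exp, Real.exp_le_one_iff]
  simp
  positivity

lemma hasDerivAt_thetaProfile (lam : ℂ) {s : ℝ} (hs : 0 < s) :
    HasDerivAt (fun t : ℝ => -Complex.exp (Complex.I * lam * t) / (4 * Real.pi * t))
      (s * gradFactor lam s) s := by
  have hs' : (s : ℂ) ≠ 0 := by exact_mod_cast hs.ne'
  have hp : (Real.pi : ℂ) ≠ 0 := by exact_mod_cast Real.pi_ne_zero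
  have hid : HasDerivAt (fun t : ℝ => (t : ℂ)) 1 s := Complex.ofRealCLM.hasDerivAt
  have h := (hasDerivAt_cexp_mul_ofReal (Complex.I * lam) s).neg.div
    (hid.const_mul (4 * Real.pi : ℂ)) (by simp [hs', hp])
  refine h.congr_deriv ?_
  simp only [gradFactor, Pi.neg_apply]
  field_simp
  ring

lemma hasDerivAt_gradFactor (lam : ℂ) {s : ℝ} (hs : 0 < s) :
    HasDerivAt (gradFactor lam)
      (-(1 / (4 * Real.pi)) * Complex.exp (Complex.I * lam * s) *
        (-lam ^ 2 / (s : ℂ) ^ 2 - 3 * Complex.I * lam / (s : ℂ) ^ 3 + 3 / (s : ℂ) ^ 4)) s := by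
  have hs' : (s : ℂ) ≠ 0 := by exact_mod_cast hs.ne'
  have hp : (Real.pi : ℂ) ≠ 0 := by exact_mod_cast Real.pi_ne_zero
  have hid : HasDerivAt (fun t : ℝ => (t : ℂ)) 1 s := Complex.ofRealCLM.hasDerivAt
  have h := ((hasDerivAt_cexp_mul_ofReal (Complex.I * lam) s).const_mul
      (-(1 / (4 * Real.pi) : ℂ))).mul
    (((hasDerivAt_const s (Complex.I * lam)).div (hid.pow 2) (pow_ne_zero 2 hs')).sub
      ((hasDerivAt_const s (1 : ℂ)).div (hid.pow 3) (pow_ne_zero 3 hs')))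
  refine h.congr_deriv ?_
  simp only [Pi.pow_apply, Pi.div_apply, Pi.sub_apply]
  field_simp
  ring_nf
  simp only [Complex.I_sq]
  ring

variable {lam : ℂ} {e : ℝ}

lemma pd_thetaReg (he : 0 < e) (i : Fin 3) :
    pd i (thetaReg lam e) = fun x => (x i : ℂ) * gradFactor lam (regRadius e x) := by
  funext x
  obtain ⟨L, hL, hLi⟩ := hasFDerivAt_comp_regRadius he
    (hasDerivAt_thetaProfile lam (regRadius_pos he x))
  have hs : (regRadius e x : ℂ) ≠ 0 := by exact_mod_cast (regRadius_pos he x).ne'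
  have : fderiv ℝ (thetaReg lam e) x = L := hL.fderiv
  rw [pd, this, hLi]
  field_simp

lemma contDiff_thetaReg (he : 0 < e) {n : WithTop ℕ∞} : ContDiff ℝ n (thetaReg lam e) := by
  have h1 : ContDiff ℝ n (fun x => (regRadius e x : ℂ)) :=
    Complex.ofRealCLM.contDiff.comp (contDiff_regRadius he)
  have h2 : ContDiff ℝ n (fun x => -Complex.exp (Complex.I * lam * regRadius e x)) :=
    (contDiff_const.mul h1).cexp.neg
  have h3 : ContDiff ℝ n (fun x => (4 * Real.pi * regRadius e x : ℂ)) := contDiff_const.mul h1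
  have h4 := h2.mul (h3.inv fun x => ?_)
  · exact (funext fun x => div_eq_mul_inv _ _ : thetaReg lam e = _) ▸ h4
  have hs : (regRadius e x : ℂ) ≠ 0 := by exact_mod_cast (regRadius_pos he x).ne'
  have hp : (Real.pi : ℂ) ≠ 0 := by exact_mod_cast Real.pi_ne_zero
  simp [hs, hp]

lemma pd_pd_thetaReg (he : 0 < e) (i : Fin 3) (x : R3) :
    pd i (pd i (thetaReg lam e)) x = gradFactor lam (regRadius e x) +
      (x i : ℂ) ^ 2 / regRadius e x * (-(1 / (4 * Real.pi)) *
        Complex.exp (Complex.I * lam * regRadius e x) *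
        (-lam ^ 2 / (regRadius e x : ℂ) ^ 2 - 3 * Complex.I * lam / (regRadius e x : ℂ) ^ 3
          + 3 / (regRadius e x : ℂ) ^ 4)) := by
  rw [pd_thetaReg he]
  obtain ⟨L, hL, hLi⟩ := hasFDerivAt_comp_regRadius he
    (hasDerivAt_gradFactor lam (regRadius_pos he x))
  have hx : HasFDerivAt (fun y : R3 => (y i : ℂ))
      (Complex.ofRealCLM.comp (EuclideanSpace.proj i : R3 →L[ℝ] ℝ)) x :=
    (Complex.ofRealCLM.comp (EuclideanSpace.proj i : R3 →L[ℝ] ℝ)).hasFDerivAt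
  have h := hx.mul hL
  rw [pd]
  erw [h.fderiv]
  simp [hLi]
  ring

/-- With Σ xᵢ² = s² the radial terms would cancel, as they do for θ away from the origin. Here Σ xᵢ²
= s² - e², so precisely a term with the factor e² is left over. -/
lemma helmholtz_thetaReg (he : 0 < e) (x : R3) :
    ∑ i, pd i (pd i (thetaReg lam e)) x + lam ^ 2 * thetaReg lam e x
      = helmFactor lam e (regRadius e x) := by
  have hs : (regRadius e x : ℂ) ≠ 0 := by exact_mod_cast (regRadius_pos he x).ne'
  have hp : (Real.pi : ℂ) ≠ 0 := by exact_mod_cast Real.pi_ne_zero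
  have hsq : (x 0 : ℂ) ^ 2 + (x 1 : ℂ) ^ 2 + (x 2 : ℂ) ^ 2 = (regRadius e x : ℂ) ^ 2 - (e : ℂ) ^ 2 := by
    have h := regRadius_sq e x
    rw [EuclideanSpace.norm_sq_eq, Fin.sum_univ_three] at h
    simp only [Real.norm_eq_abs, sq_abs] at h
    have h' := congrArg (fun t : ℝ => (t : ℂ)) h
    push_cast at h'
    rw [h']; ring
  have h2 : (x 2 : ℂ) ^ 2 = (regRadius e x : ℂ) ^ 2 - (e : ℂ) ^ 2 - (x 0 : ℂ) ^ 2 - (x 1 : ℂ) ^ 2 := by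
    rw [← hsq]; ring
  simp only [Fin.sum_univ_three, pd_pd_thetaReg he]
  rw [h2]
  simp only [thetaReg, helmFactor, gradFactor]
  field_simp
  ring

end

/-! ### Kernel bounds and the weak gradient of the fundamental solution -/

section

lemma ae_ne_zero : ∀ᵐ x : R3, x ≠ 0 := compl_mem_ae_iff.2 (measure_singleton 0)

lemma locallyIntegrable_of_norm_le_rpow {f : R3 → ℝ} {α : ℝ} (hα : α < 3)
    (hm : AEStronglyMeasurable f) (h : ∀ x, ‖f x‖ ≤ 1 * ‖x‖ ^ (-α)) : LocallyIntegrable f := by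
  intro x
  -- Balls about the origin serve as neighbourhoods of every point, so one integrability statement
  -- at the singularity suffices.
  refine ⟨Metric.ball 0 (‖x‖ + 1), Metric.isOpen_ball.mem_nhds (by simp), ?_⟩
  exact integrableOn_ball_of_norm_le_rpow (C := 1) (α := α) (by simp) (by simpa using hα)
    (Eventually.of_forall h) hm

lemma locallyIntegrable_norm_inv : LocallyIntegrable fun x : R3 => ‖x‖⁻¹ := by
  refine locallyIntegrable_of_norm_le_rpow (α := 1) (by norm_num)
    (measurable_norm.inv.aestronglyMeasurable) fun x => ?_
  simp [Real.rpow_neg_one]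

lemma locallyIntegrable_norm_sq_inv : LocallyIntegrable fun x : R3 => (‖x‖ ^ 2)⁻¹ := by
  refine locallyIntegrable_of_norm_le_rpow (α := 2) (by norm_num)
    ((measurable_norm.pow_const 2).inv.aestronglyMeasurable) fun x => ?_
  rw [Real.rpow_neg (norm_nonneg x)]
  simp

/-- The radial majorant of the first derivatives of the fundamental solution. -/
def gradBound (lam : ℂ) (x : R3) : ℝ := ‖lam‖ * ‖x‖⁻¹ + (‖x‖ ^ 2)⁻¹

lemma locallyIntegrable_gradBound (lam : ℂ) : LocallyIntegrable (gradBound lam) :=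
  (locallyIntegrable_norm_inv.smul ‖lam‖).add locallyIntegrable_norm_sq_inv

variable {lam : ℂ} {e : ℝ}

lemma norm_thetaProfile_le (hlam : 0 ≤ lam.im) {s : ℝ} (hs : 0 ≤ s) :
    ‖-Complex.exp (Complex.I * lam * s) / (4 * Real.pi * s)‖ ≤ s⁻¹ := by
  have hpi := Real.pi_gt_three
  rw [norm_div, norm_neg, div_eq_mul_inv]
  have h1 : ‖(4 * Real.pi * s : ℂ)‖ = 4 * Real.pi * s := by
    rw [← Complex.ofReal_ofNat, ← Complex.ofReal_mul, ← Complex.ofReal_mul, Complex.norm_real,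
      Real.norm_of_nonneg (by positivity)]
  rw [h1]
  calc _ ≤ 1 * (4 * Real.pi * s)⁻¹ := by gcongr; exact norm_cexp_le_one hlam hs
    _ = (4 * Real.pi)⁻¹ * s⁻¹ := by rw [one_mul, mul_inv]
    _ ≤ 1 * s⁻¹ := by
        gcongr
        exact inv_le_one_of_one_le₀ (by linarith)
    _ = _ := one_mul _

lemma norm_gradFactor_le (hlam : 0 ≤ lam.im) {s : ℝ} (hs : 0 ≤ s) :
    ‖gradFactor lam s‖ ≤ ‖lam‖ / s ^ 2 + 1 / s ^ 3 := by
  have hpi := Real.pi_gt_three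
  have h1 : ‖-(1 / (4 * Real.pi) : ℂ)‖ ≤ 1 := by
    rw [norm_neg, norm_div, norm_one, norm_mul, Complex.norm_real,
      Real.norm_of_nonneg Real.pi_pos.le, div_le_one (by simp [Real.pi_pos])]
    norm_num
    linarith
  have h2 : ‖Complex.I * lam / (s : ℂ) ^ 2 - 1 / (s : ℂ) ^ 3‖ ≤ ‖lam‖ / s ^ 2 + 1 / s ^ 3 := by
    refine (norm_sub_le _ _).trans (le_of_eq ?_)
    simp [abs_of_nonneg hs]
  rw [gradFactor, norm_mul, norm_mul]
  calc _ ≤ 1 * 1 * (‖lam‖ / s ^ 2 + 1 / s ^ 3) := by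
        gcongr
        exact norm_cexp_le_one hlam hs
    _ = _ := by ring

lemma norm_thetaReg_le (hlam : 0 ≤ lam.im) (e : ℝ) {x : R3} (hx : x ≠ 0) :
    ‖thetaReg lam e x‖ ≤ ‖x‖⁻¹ :=
  (norm_thetaProfile_le hlam (Real.sqrt_nonneg _)).trans
    (inv_anti₀ (norm_pos_iff.2 hx) (norm_le_regRadius e x))

lemma norm_coord_le (x : R3) (i : Fin 3) : ‖(x i : ℂ)‖ ≤ ‖x‖ := by
  rw [Complex.norm_real]
  exact PiLp.norm_apply_le x i

lemma norm_coord_mul_gradFactor_le (hlam : 0 ≤ lam.im) {x : R3} (hx : x ≠ 0) {s : ℝ}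
    (hs : ‖x‖ ≤ s) (i : Fin 3) : ‖(x i : ℂ) * gradFactor lam s‖ ≤ gradBound lam x := by
  have hx' : 0 < ‖x‖ := norm_pos_iff.2 hx
  have hs' : 0 < s := hx'.trans_le hs
  rw [norm_mul]
  calc _ ≤ s * (‖lam‖ / s ^ 2 + 1 / s ^ 3) := by
        gcongr
        · exact (norm_coord_le x i).trans hs
        · exact norm_gradFactor_le hlam hs'.le
    _ = ‖lam‖ * s⁻¹ + (s ^ 2)⁻¹ := by field_simp
    _ ≤ _ := by
        unfold gradBound
        gcongr

/-- Identifies the kernel with minus the e → 0 limit of ∂ᵢ `thetaReg`. At the origin both sides are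
0 because of the factor xᵢ. -/
lemma vecE_eq (lam : ℂ) (x : R3) (i : Fin 3) :
    vecE lam x i = -((x i : ℂ) * gradFactor lam ‖x‖) := by
  rcases eq_or_ne x 0 with rfl | hx
  · simp [vecE]
  have hx' : (‖x‖ : ℂ) ≠ 0 := by simpa using hx
  have hp : (Real.pi : ℂ) ≠ 0 := by exact_mod_cast Real.pi_ne_zero
  simp only [vecE, theta, gradFactor]
  field_simp
  ring

lemma measurable_theta (lam : ℂ) : Measurable (theta lam) := by
  unfold theta; fun_prop

lemma measurable_vecE (lam : ℂ) (i : Fin 3) : Measurable fun x => vecE lam x i := by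
  have := measurable_theta lam
  unfold vecE; fun_prop

lemma norm_theta_le (hlam : 0 ≤ lam.im) (x : R3) : ‖theta lam x‖ ≤ ‖x‖⁻¹ :=
  norm_thetaProfile_le hlam (norm_nonneg x)

lemma norm_vecE_le (hlam : 0 ≤ lam.im) (x : R3) (i : Fin 3) :
    ‖vecE lam x i‖ ≤ gradBound lam x := by
  rcases eq_or_ne x 0 with rfl | hx
  · simp [vecE, gradBound]
  rw [vecE_eq, norm_neg]
  exact norm_coord_mul_gradFactor_le hlam hx le_rfl i

lemma locallyIntegrable_theta (hlam : 0 ≤ lam.im) : LocallyIntegrable (theta lam) :=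
  locallyIntegrable_norm_inv.mono (measurable_theta lam).aestronglyMeasurable
    (Eventually.of_forall fun x => (norm_theta_le hlam x).trans (le_abs_self _))

lemma locallyIntegrable_vecE (hlam : 0 ≤ lam.im) (i : Fin 3) :
    LocallyIntegrable fun x => vecE lam x i :=
  (locallyIntegrable_gradBound lam).mono (measurable_vecE lam i).aestronglyMeasurable
    (Eventually.of_forall fun x => (norm_vecE_le hlam x i).trans (le_abs_self _))

variable {φ : R3 → ℂ}

lemma IsTest.integrable_norm_mul {Ω : Set R3} (h : IsTest Ω φ) {b : R3 → ℝ}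
    (hb : LocallyIntegrable b) : Integrable fun x => ‖φ x‖ * b x := by
  have h1 : LocallyIntegrable fun x => (b x : ℂ) :=
    hb.mono (Complex.continuous_ofReal.comp_aestronglyMeasurable hb.aestronglyMeasurable)
      (Eventually.of_forall fun x => by simp)
  refine ((h.mono (Set.subset_univ Ω)).integrable_mul
    (h1.locallyIntegrableOn _)).norm.mono' ?_ ?_
  · exact h.continuous.norm.aestronglyMeasurable.mul hb.aestronglyMeasurable
  · exact Eventually.of_forall fun x => by simp

/-- Dominated convergence for the regularised kernels. The origin, where the bound and the limit may
fail, is a null set. -/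
lemma tendsto_pair_of_dominated {Ω : Set R3} (hφ : IsTest Ω φ) {F : ℝ → R3 → ℂ} {f : R3 → ℂ}
    {b : R3 → ℝ} (hb : LocallyIntegrable b) (hF : ∀ e > 0, Continuous (F e))
    (hFb : ∀ e > 0, ∀ x, x ≠ 0 → ‖F e x‖ ≤ b x)
    (hlim : ∀ x, x ≠ 0 → Tendsto (fun e => F e x) (𝓝[>] 0) (𝓝 (f x))) :
    Tendsto (fun e => pair (F e) φ) (𝓝[>] 0) (𝓝 (pair f φ)) := by
  refine tendsto_integral_filter_of_dominated_convergence (fun x => ‖φ x‖ * b x) ?_ ?_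
    (hφ.integrable_norm_mul hb) ?_
  · filter_upwards [self_mem_nhdsWithin] with e he
    exact (hφ.continuous.mul (hF e he)).aestronglyMeasurable
  · filter_upwards [self_mem_nhdsWithin] with e he
    filter_upwards [ae_ne_zero] with x hx
    rw [norm_mul]
    gcongr
    exact hFb e he x hx
  · filter_upwards [ae_ne_zero] with x hx
    exact (hlim x hx).const_mul _

lemma tendsto_pair_thetaReg {Ω : Set R3} (hlam : 0 ≤ lam.im) (hφ : IsTest Ω φ) :
    Tendsto (fun e => pair (thetaReg lam e) φ) (𝓝[>] 0) (𝓝 (pair (theta lam) φ)) :=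
  tendsto_pair_of_dominated hφ locallyIntegrable_norm_inv
    (fun _ he => (contDiff_thetaReg he (n := 0)).continuous)
    (fun e _ _ hx => norm_thetaReg_le hlam e hx)
    fun x hx => (hasDerivAt_thetaProfile lam (norm_pos_iff.2 hx)).continuousAt.tendsto.comp
      (tendsto_regRadius x)

lemma continuous_pd_thetaReg (he : 0 < e) (i : Fin 3) : Continuous (pd i (thetaReg lam e)) :=
  (contDiff_pd i (contDiff_thetaReg he)).continuous

lemma tendsto_pair_pd_thetaReg {Ω : Set R3} (hlam : 0 ≤ lam.im) (hφ : IsTest Ω φ) (i : Fin 3) :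
    Tendsto (fun e => pair (pd i (thetaReg lam e)) φ) (𝓝[>] 0)
      (𝓝 (pair (fun x => -vecE lam x i) φ)) := by
  refine tendsto_pair_of_dominated hφ (locallyIntegrable_gradBound lam)
    (fun e he => continuous_pd_thetaReg he i) (fun e he x hx => ?_) fun x hx => ?_
  · rw [pd_thetaReg he]
    exact norm_coord_mul_gradFactor_le hlam hx (norm_le_regRadius e x) i
  · rw [vecE_eq, neg_neg]
    have h := ((hasDerivAt_gradFactor lam (norm_pos_iff.2 hx)).continuousAt.tendsto.comp
      (tendsto_regRadius x)).const_mul (x i : ℂ)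
    refine h.congr' ?_
    filter_upwards [self_mem_nhdsWithin] with e he
    rw [pd_thetaReg he]
    rfl

/-- `vecE` is the negative weak gradient of `theta` on the whole space. -/
lemma pair_theta_pd (hlam : 0 ≤ lam.im) (hφ : IsTest Set.univ φ) (i : Fin 3) :
    pair (theta lam) (pd i φ) = pair (fun x => vecE lam x i) φ := by
  have h1 := tendsto_pair_thetaReg hlam (hφ.pd i)
  have h2 := (tendsto_pair_pd_thetaReg hlam hφ i).neg
  have h3 : pair (fun x => vecE lam x i) φ = -pair (fun x => -vecE lam x i) φ := by
    simp [pair, integral_neg]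
  rw [h3]
  -- Integration by parts is legitimate for the smooth kernels `thetaReg`, and both sides have
  -- limits as e → 0.
  refine tendsto_nhds_unique h1 (h2.congr' ?_)
  filter_upwards [self_mem_nhdsWithin] with e he
  rw [pair_pd isOpen_univ hφ (contDiff_thetaReg he).contDiffOn, neg_neg]

end

/-! ### The regularised kernels as an approximate identity -/

section

/-- An explicit primitive of the radial density r²(r² + 1)^(-5/2), used to compute the mass of the
limiting kernel. -/
lemma hasDerivAt_cube_div_sqrt (r : ℝ) :
    HasDerivAt (fun t : ℝ => (1 / 3) * (t / Real.sqrt (t ^ 2 + 1)) ^ 3)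
      (r ^ 2 * (Real.sqrt (r ^ 2 + 1) ^ 5)⁻¹) r := by
  have hs : 0 < Real.sqrt (r ^ 2 + 1) := Real.sqrt_pos.2 (by positivity)
  have hsq : Real.sqrt (r ^ 2 + 1) ^ 2 = r ^ 2 + 1 := Real.sq_sqrt (by positivity)
  have h1 : HasDerivAt (fun t : ℝ => Real.sqrt (t ^ 2 + 1)) (r / Real.sqrt (r ^ 2 + 1)) r := by
    have := ((hasDerivAt_pow 2 r).add_const 1).sqrt (by positivity : r ^ 2 + 1 ≠ 0)
    refine this.congr_deriv ?_
    field_simp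
    simp
  have h2 := ((((hasDerivAt_id r).div h1 hs.ne').pow 3).const_mul (1 / 3 : ℝ))
  refine h2.congr_deriv ?_
  simp only [Pi.div_apply, id]
  clear h1 h2
  generalize Real.sqrt (r ^ 2 + 1) = w at *
  have hw : w ≠ 0 := hs.ne'
  field_simp
  have h3 : w ^ 2 * (r / w) ^ (3 - 1) = r ^ 2 := by
    norm_num
    field_simp
  push_cast
  linear_combination 3 * (w ^ 2 - r ^ 2) * h3 + 3 * r ^ 2 * hsq

/-- Polar coordinates give 3 · (4π/3) · (1/3): dimension, volume of the unit ball, radial integral.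
This fixes the constant 4π in θ. -/
lemma integral_regRadius_one_inv_pow :
    ∫ y : R3, (regRadius 1 y ^ 5)⁻¹ = 4 * Real.pi / 3 := by
  have h := integral_fun_norm_addHaar (volume : Measure R3)
    (fun r => (Real.sqrt (r ^ 2 + 1) ^ 5)⁻¹)
  have hI : ∫ r in Set.Ioi (0 : ℝ), r ^ 2 * (Real.sqrt (r ^ 2 + 1) ^ 5)⁻¹ = 1 / 3 := by
    have hlim : Tendsto (fun t : ℝ => (1 / 3) * (t / Real.sqrt (t ^ 2 + 1)) ^ 3) atTop
        (𝓝 ((1 / 3) * 1 ^ 3)) := by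
      refine ((Tendsto.pow ?_ 3).const_mul _)
      have h1 : Tendsto (fun t : ℝ => Real.sqrt (1 - (t ^ 2 + 1)⁻¹)) atTop
          (𝓝 (Real.sqrt (1 - 0))) := by
        refine (Tendsto.sub tendsto_const_nhds (tendsto_inv_atTop_zero.comp ?_)).sqrt
        exact tendsto_atTop_add_const_right _ _ (tendsto_pow_atTop two_ne_zero)
      simp only [sub_zero, Real.sqrt_one] at h1
      refine h1.congr' ?_
      filter_upwards [eventually_ge_atTop 0] with t ht
      have : 1 - (t ^ 2 + 1)⁻¹ = t ^ 2 / (t ^ 2 + 1) := by field_simp; ring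
      rw [this, Real.sqrt_div (sq_nonneg t), Real.sqrt_sq ht]
    have := integral_Ioi_of_hasDerivAt_of_nonneg (a := 0)
      (hasDerivAt_cube_div_sqrt 0).continuousAt.continuousWithinAt
      (fun r _ => hasDerivAt_cube_div_sqrt r) (fun r _ => by positivity) hlim
    rw [this]
    simp
  have hv : (volume : Measure R3).real (Metric.ball 0 1) = 4 * Real.pi / 3 := by
    rw [measureReal_def, EuclideanSpace.volume_ball_fin_three]
    simp [ENNReal.toReal_ofReal (by positivity : 0 ≤ Real.pi * 4 / 3)]
    ring
  have h' : ∫ y : R3, (regRadius 1 y ^ 5)⁻¹ =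
      ∫ y : R3, (Real.sqrt (‖y‖ ^ 2 + 1) ^ 5)⁻¹ := by
    simp [regRadius]
  rw [h', h, hv]
  simp only [finrank_euclideanSpace, Fintype.card_fin, nsmul_eq_mul, smul_eq_mul]
  norm_num at hI ⊢
  rw [hI]
  ring

/-- The exponent 4 exceeds the dimension 3; this is the majorant for the rescaled kernels. -/
lemma integrable_regRadius_one_inv_pow : Integrable fun y : R3 => (regRadius 1 y ^ 4)⁻¹ := by
  have h := integrable_rpow_neg_one_add_norm_sq (μ := (volume : Measure R3)) (r := 4)
    (by simp; norm_num)
  refine h.congr (Eventually.of_forall fun y => ?_)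
  have h2 : regRadius 1 y ^ 4 = (1 + ‖y‖ ^ 2) ^ 2 := by
    rw [show (4 : ℕ) = 2 * 2 from rfl, pow_mul, regRadius_sq]
    ring
  simp only [h2]
  rw [show (-4 / 2 : ℝ) = -(2 : ℕ) by norm_num, Real.rpow_neg (by positivity), Real.rpow_natCast]

lemma regRadius_smul {e : ℝ} (he : 0 < e) (y : R3) : regRadius e (e • y) = e * regRadius 1 y := by
  rw [regRadius, regRadius, norm_smul, Real.norm_of_nonneg he.le]
  rw [show (e * ‖y‖) ^ 2 + e ^ 2 = e ^ 2 * (‖y‖ ^ 2 + 1 ^ 2) by ring, Real.sqrt_mul (sq_nonneg e),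
    Real.sqrt_sq he.le]

lemma one_le_regRadius_one (y : R3) : 1 ≤ regRadius 1 y :=
  Real.le_sqrt_of_sq_le (by nlinarith [sq_nonneg ‖y‖])

lemma regRadius_one_le (y : R3) : regRadius 1 y ≤ ‖y‖ + 1 :=
  Real.sqrt_le_iff.2 ⟨by positivity, by nlinarith [norm_nonneg y]⟩

/-- The rescaled kernel of `(Δ + λ²) thetaReg`. -/
def scaledHelm (lam : ℂ) (e s : ℝ) : ℂ :=
  1 / (4 * Real.pi) * Complex.exp (Complex.I * lam * (e * s : ℝ)) *
    (3 / (s : ℂ) ^ 5 - 3 * Complex.I * lam * e / (s : ℂ) ^ 4 - lam ^ 2 * e ^ 2 / (s : ℂ) ^ 3)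

variable {lam : ℂ} {e : ℝ} {φ : R3 → ℂ}

lemma pow_mul_helmFactor (lam : ℂ) (he : 0 < e) {s : ℝ} (hs : 0 < s) :
    (e : ℂ) ^ 3 * helmFactor lam e (e * s) = scaledHelm lam e s := by
  have hs' : (s : ℂ) ≠ 0 := by exact_mod_cast hs.ne'
  have he' : (e : ℂ) ≠ 0 := by exact_mod_cast he.ne'
  have hp : (Real.pi : ℂ) ≠ 0 := by exact_mod_cast Real.pi_ne_zero
  simp only [helmFactor, scaledHelm]
  push_cast
  field_simp

/-- The substitution x = ey, whose Jacobian e³ is absorbed into the kernel by `pow_mul_helmFactor`.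
-/
lemma pair_helmFactor (lam : ℂ) (he : 0 < e) (φ : R3 → ℂ) :
    pair (fun x => helmFactor lam e (regRadius e x)) φ
      = ∫ y, φ (e • y) * scaledHelm lam e (regRadius 1 y) := by
  have h := Measure.integral_comp_smul (volume : Measure R3)
    (fun x => φ x * helmFactor lam e (regRadius e x)) e
  have he3 : |(e ^ 3)⁻¹| = (e ^ 3)⁻¹ := abs_of_pos (by positivity)
  have he' : (e : ℂ) ≠ 0 := by exact_mod_cast he.ne'
  simp only [finrank_euclideanSpace, Fintype.card_fin, he3, regRadius_smul he] at h
  have h2 : (fun y => φ (e • y) * scaledHelm lam e (regRadius 1 y)) = fun y =>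
      (e : ℂ) ^ 3 * (φ (e • y) * helmFactor lam e (e * regRadius 1 y)) := by
    funext y
    rw [← pow_mul_helmFactor lam he (regRadius_pos one_pos y)]
    ring
  rw [h2, integral_const_mul, h, pair, Complex.real_smul]
  push_cast
  field_simp

/-- The term λ²e²/s³ alone decays too slowly to be integrable over ℝ³. The constraint es ≤ ρ,
available on the support of a rescaled test function, trades e² for ρ/s. -/
lemma norm_scaledHelm_le (hlam : 0 ≤ lam.im) (he : 0 < e) (he1 : e ≤ 1) {s ρ : ℝ} (hs : 1 ≤ s)
    (hρ : e * s ≤ ρ) :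
    ‖scaledHelm lam e s‖ ≤ (3 + 3 * ‖lam‖ + ‖lam‖ ^ 2 * ρ) * (s ^ 4)⁻¹ := by
  have hs0 : 0 < s := by linarith
  have hpi := Real.pi_gt_three
  have h1 : ‖(1 / (4 * Real.pi) : ℂ)‖ ≤ 1 := by
    rw [norm_div, norm_one, norm_mul, Complex.norm_real,
      Real.norm_of_nonneg Real.pi_pos.le, div_le_one (by simp [Real.pi_pos])]
    norm_num
    linarith
  have h2 : ‖3 / (s : ℂ) ^ 5 - 3 * Complex.I * lam * e / (s : ℂ) ^ 4
      - lam ^ 2 * e ^ 2 / (s : ℂ) ^ 3‖ ≤ (3 + 3 * ‖lam‖ + ‖lam‖ ^ 2 * ρ) * (s ^ 4)⁻¹ := by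
    have ha : ‖3 / (s : ℂ) ^ 5‖ ≤ 3 * (s ^ 4)⁻¹ := by
      simp only [norm_div, norm_pow, Complex.norm_real, Real.norm_of_nonneg hs0.le,
        Complex.norm_ofNat]
      rw [div_eq_mul_inv]
      gcongr 3 * (?_)⁻¹
      exact pow_le_pow_right₀ hs (by norm_num)
    have hb : ‖3 * Complex.I * lam * e / (s : ℂ) ^ 4‖ ≤ 3 * ‖lam‖ * (s ^ 4)⁻¹ := by
      simp only [norm_div, norm_pow, norm_mul, Complex.norm_real, Real.norm_of_nonneg hs0.le,
        Real.norm_of_nonneg he.le, Complex.norm_ofNat, Complex.norm_I, mul_one]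
      rw [div_eq_mul_inv]
      gcongr ?_ * _
      exact mul_le_of_le_one_right (by positivity) he1
    have hc : ‖lam ^ 2 * e ^ 2 / (s : ℂ) ^ 3‖ ≤ ‖lam‖ ^ 2 * ρ * (s ^ 4)⁻¹ := by
      simp only [norm_div, norm_pow, norm_mul, Complex.norm_real, Real.norm_of_nonneg hs0.le,
        Real.norm_of_nonneg he.le]
      have : e ^ 2 ≤ ρ * s⁻¹ := by
        rw [← div_eq_mul_inv, le_div_iff₀ hs0]
        calc e ^ 2 * s = e * (e * s) := by ring
          _ ≤ 1 * ρ := by gcongr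
          _ = ρ := one_mul _
      calc _ ≤ ‖lam‖ ^ 2 * (ρ * s⁻¹) / s ^ 3 := by gcongr
        _ = _ := by field_simp
    calc _ ≤ 3 * (s ^ 4)⁻¹ + 3 * ‖lam‖ * (s ^ 4)⁻¹ + ‖lam‖ ^ 2 * ρ * (s ^ 4)⁻¹ :=
          (norm_sub_le _ _).trans (add_le_add ((norm_sub_le _ _).trans (add_le_add ha hb)) hc)
      _ = _ := by ring
  rw [scaledHelm, norm_mul, norm_mul]
  calc _ ≤ 1 * 1 * ((3 + 3 * ‖lam‖ + ‖lam‖ ^ 2 * ρ) * (s ^ 4)⁻¹) := by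
        gcongr
        exact norm_cexp_le_one hlam (by positivity)
    _ = _ := by ring

/-- After rescaling, only the term 3/(4πs⁵) survives as e → 0, and its total mass is (3/4π)(4π/3) =
1. -/
lemma tendsto_pair_helmFactor {Ω : Set R3} (hlam : 0 ≤ lam.im) (hφ : IsTest Ω φ) :
    Tendsto (fun e => pair (fun x => helmFactor lam e (regRadius e x)) φ) (𝓝[>] 0) (𝓝 (φ 0)) := by
  obtain ⟨C, hC⟩ := hφ.exists_bound
  obtain ⟨ρ, hρ0, hρ⟩ := hφ.compact.isCompact.isBounded.subset_closedBall_lt 0 0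
  have hlim : φ 0 = ∫ y : R3, φ 0 * scaledHelm lam 0 (regRadius 1 y) := by
    have : ∀ y : R3, φ 0 * scaledHelm lam 0 (regRadius 1 y)
        = φ 0 * (3 / (4 * Real.pi)) * (((regRadius 1 y ^ 5)⁻¹ : ℝ) : ℂ) := fun y => by
      simp only [scaledHelm]
      push_cast
      simp
      ring
    simp only [this]
    rw [integral_const_mul, integral_complex_ofReal, integral_regRadius_one_inv_pow]
    have hp : (Real.pi : ℂ) ≠ 0 := by exact_mod_cast Real.pi_ne_zero
    push_cast
    field_simp
  have hr : Continuous (fun y : R3 => (regRadius 1 y : ℂ)) :=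
    Complex.continuous_ofReal.comp (contDiff_regRadius one_pos (n := 0)).continuous
  have hr0 : ∀ y : R3, (regRadius 1 y : ℂ) ≠ 0 := fun y => by
    exact_mod_cast (regRadius_pos one_pos y).ne'
  have key : Tendsto (fun e : ℝ => ∫ y, φ (e • y) * scaledHelm lam e (regRadius 1 y)) (𝓝[>] 0)
      (𝓝 (∫ y : R3, φ 0 * scaledHelm lam 0 (regRadius 1 y))) := by
    -- Where φ(ey) can be nonzero, e|y| ≤ ρ, so for e ≤ 1 one has e√(|y|² + 1) ≤ e|y| + e ≤ ρ + 1;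
    -- this explains ρ + 1 in the majorant.
    refine tendsto_integral_filter_of_dominated_convergence
      (fun y => C * ((3 + 3 * ‖lam‖ + ‖lam‖ ^ 2 * (ρ + 1)) * (regRadius 1 y ^ 4)⁻¹)) ?_ ?_
      ((integrable_regRadius_one_inv_pow.const_mul _).const_mul _) ?_
    · refine Eventually.of_forall fun e => Continuous.aestronglyMeasurable ?_
      refine (hφ.continuous.comp (continuous_const_smul e)).mul ?_
      unfold scaledHelm
      push_cast
      refine Continuous.mul (by fun_prop) (((continuous_const.div (hr.pow 5)
        fun y => pow_ne_zero _ (hr0 y)).sub (continuous_const.div (hr.pow 4)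
        fun y => pow_ne_zero _ (hr0 y))).sub (continuous_const.div (hr.pow 3)
        fun y => pow_ne_zero _ (hr0 y)))
    · filter_upwards [Ioc_mem_nhdsGT one_pos] with e he
      refine Eventually.of_forall fun y => ?_
      have hC0 : 0 ≤ C := (norm_nonneg _).trans (hC 0)
      by_cases hy : e • y ∈ tsupport φ
      · have h1 : e * ‖y‖ ≤ ρ := by
          have := hρ hy
          rwa [mem_closedBall_zero_iff, norm_smul, Real.norm_of_nonneg he.1.le] at this
        rw [norm_mul]
        gcongr
        · exact hC _
        · refine norm_scaledHelm_le hlam he.1 he.2 (one_le_regRadius_one y) ?_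
          calc e * regRadius 1 y ≤ e * (‖y‖ + 1) := by
                gcongr
                · exact he.1.le
                · exact regRadius_one_le y
            _ = e * ‖y‖ + e := by ring
            _ ≤ ρ + 1 := add_le_add h1 he.2
      · rw [image_eq_zero_of_notMem_tsupport hy, zero_mul, norm_zero]
        positivity
    · refine Eventually.of_forall fun y => ?_
      have hcont : Continuous fun e : ℝ => φ (e • y) * scaledHelm lam e (regRadius 1 y) := by
        refine (hφ.continuous.comp (by fun_prop)).mul ?_
        unfold scaledHelm
        fun_prop
      have := (hcont.tendsto 0).mono_left (nhdsWithin_le_nhds (s := Set.Ioi 0))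
      simpa using this
  rw [← hlim] at key
  refine key.congr' ?_
  filter_upwards [self_mem_nhdsWithin] with e he
  exact (pair_helmFactor lam he φ).symm

/-- The Helmholtz operator `Δ + λ²`. -/
def helm (lam : ℂ) (φ : R3 → ℂ) (x : R3) : ℂ := ∑ i, pd i (pd i φ) x + lam ^ 2 * φ x

lemma helm_eq (lam : ℂ) (φ : R3 → ℂ) : helm lam φ = fun x =>
    (pd 0 (pd 0 φ) x + pd 1 (pd 1 φ) x + pd 2 (pd 2 φ) x) + lam ^ 2 * φ x := by
  funext x
  simp only [helm, Fin.sum_univ_three]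

lemma pair_helm {Ω : Set R3} {f : R3 → ℂ} (hφ : IsTest Ω φ) (hf : LocallyIntegrableOn f Ω) :
    pair f (helm lam φ) = pair f (pd 0 (pd 0 φ)) + pair f (pd 1 (pd 1 φ)) +
      pair f (pd 2 (pd 2 φ)) + lam ^ 2 * pair f φ := by
  have h := fun i => (hφ.pd i).pd i
  rw [helm_eq, pair_add_right (((h 0).add (h 1)).add (h 2)) (hφ.const_mul _) hf,
    pair_add_right ((h 0).add (h 1)) (h 2) hf, pair_add_right (h 0) (h 1) hf,
    pair_const_mul_right]

lemma IsTest.helm {Ω : Set R3} (hφ : IsTest Ω φ) (lam : ℂ) : IsTest Ω (helm lam φ) := by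
  have h := fun i => (hφ.pd i).pd i
  rw [helm_eq]
  exact (((h 0).add (h 1)).add (h 2)).add (hφ.const_mul _)

/-- `theta` is a fundamental solution of the Helmholtz operator. -/
lemma pair_theta_helm (hlam : 0 ≤ lam.im) (hφ : IsTest Set.univ φ) :
    pair (theta lam) (helm lam φ) = φ 0 := by
  refine tendsto_nhds_unique (tendsto_pair_thetaReg hlam (hφ.helm lam))
    ((tendsto_pair_helmFactor hlam hφ).congr' ?_)
  filter_upwards [self_mem_nhdsWithin] with e he
  have hc : ContDiff ℝ (⊤ : ℕ∞) (thetaReg lam e) := contDiff_thetaReg he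
  have hl : ∀ {f : R3 → ℂ}, ContDiff ℝ (⊤ : ℕ∞) f → LocallyIntegrableOn f Set.univ :=
    fun hf => hf.continuous.locallyIntegrable.locallyIntegrableOn _
  -- For e > 0 the kernel is smooth, so both derivatives may be moved onto it.
  have h1 : ∀ i, pair (thetaReg lam e) (pd i (pd i φ)) = pair (pd i (pd i (thetaReg lam e))) φ := by
    intro i
    rw [pair_pd isOpen_univ hφ ((contDiff_pd i hc).of_le (by simp)).contDiffOn,
      pair_pd isOpen_univ (hφ.pd i) (hc.of_le (by simp)).contDiffOn, neg_neg]
  have h2 := fun i => hl (contDiff_pd i (contDiff_pd i hc))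
  rw [pair_helm hφ (hl hc), h1, h1, h1, ← pair_const_mul_left,
    ← pair_add_left hφ (h2 0) (h2 1)]
  erw [← pair_add_left hφ ((h2 0).add (h2 1)) (h2 2),
    ← pair_add_left hφ (((h2 0).add (h2 1)).add (h2 2)) ((hl hc).smul (lam ^ 2))]
  congr 1
  funext x
  rw [← helmholtz_thetaReg he, Fin.sum_univ_three]
  rfl

end

/-! ### Compactly supported parametrices -/

lemma pd_comp_neg (φ : R3 → ℂ) (i : Fin 3) (x : R3) :
    pd i (fun y => φ (-y)) x = -pd i φ (-x) := by
  have h := (ContinuousLinearEquiv.neg ℝ (M := R3)).comp_right_fderiv (f := φ) (x := x)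
  have h' : fderiv ℝ (fun y => φ (-y)) x = _ := h
  simp [pd, h']

lemma pd_of_even {φ : R3 → ℂ} (h : ∀ x, φ (-x) = φ x) (i : Fin 3) (x : R3) :
    pd i φ (-x) = -pd i φ x := by
  have h1 := pd_comp_neg φ i x
  rw [show (fun y => φ (-y)) = φ from funext h] at h1
  rw [h1, neg_neg]

lemma pd_of_odd {φ : R3 → ℂ} (h : ∀ x, φ (-x) = -φ x) (i : Fin 3) (x : R3) :
    pd i φ (-x) = pd i φ x := by
  have h1 := pd_comp_neg φ i x
  rw [show (fun y => φ (-y)) = fun y => -φ y from funext h] at h1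
  have h2 : pd i (fun y => -φ y) x = -pd i φ x := by simp [pd, fderiv_fun_neg]
  rw [h2, neg_inj] at h1
  exact h1.symm

lemma contDiffAt_ofReal_norm {x : R3} (hx : x ≠ 0) {n : WithTop ℕ∞} :
    ContDiffAt ℝ n (fun y : R3 => (‖y‖ : ℂ)) x :=
  Complex.ofRealCLM.contDiff.contDiffAt.comp x (contDiffAt_norm ℝ hx)

lemma contDiffAt_theta (lam : ℂ) {x : R3} (hx : x ≠ 0) {n : WithTop ℕ∞} :
    ContDiffAt ℝ n (theta lam) x := by
  have h1 := contDiffAt_ofReal_norm hx (n := n)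
  have hx' : (‖x‖ : ℂ) ≠ 0 := by simpa using hx
  have hp : (Real.pi : ℂ) ≠ 0 := by exact_mod_cast Real.pi_ne_zero
  have h2 : ContDiffAt ℝ n (fun x : R3 => -Complex.exp (Complex.I * lam * ‖x‖)) x :=
    (contDiffAt_const.mul h1).cexp.neg
  have h3 : ContDiffAt ℝ n (fun x : R3 => (4 * Real.pi * ‖x‖ : ℂ)) x := contDiffAt_const.mul h1
  have h4 := h2.mul (h3.inv (by simp [hx, hp]))
  exact (funext fun x => div_eq_mul_inv _ _ : theta lam = _) ▸ h4

lemma contDiffAt_vecE (lam : ℂ) (i : Fin 3) {x : R3} (hx : x ≠ 0) {n : WithTop ℕ∞} :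
    ContDiffAt ℝ n (fun y => vecE lam y i) x := by
  have h1 := contDiffAt_ofReal_norm hx (n := n)
  have hx' : (‖x‖ : ℂ) ≠ 0 := by simpa using hx
  have hc : ContDiffAt ℝ n (fun y : R3 => (y i : ℂ)) x :=
    (Complex.ofRealCLM.comp (EuclideanSpace.proj i : R3 →L[ℝ] ℝ)).contDiff.contDiffAt
  have h2 := (contDiffAt_theta lam hx (n := n)).mul
    ((hc.mul ((h1.pow 2).inv (pow_ne_zero 2 hx'))).sub
      ((contDiffAt_const (c := Complex.I * lam)).mul hc |>.mul (h1.inv hx')))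
  have h3 : (fun y => vecE lam y i) = fun y => theta lam y *
      ((y i : ℂ) * ((‖y‖ : ℂ) ^ 2)⁻¹ - Complex.I * lam * (y i : ℂ) * (‖y‖ : ℂ)⁻¹) := by
    funext y
    simp only [vecE, div_eq_mul_inv]
  rw [h3]
  exact h2

lemma theta_neg (lam : ℂ) (x : R3) : theta lam (-x) = theta lam x := by simp [theta]

lemma vecE_neg (lam : ℂ) (x : R3) (i : Fin 3) : vecE lam (-x) i = -vecE lam x i := by
  simp only [vecE, theta_neg, norm_neg, PiLp.neg_apply, Complex.ofReal_neg]
  ring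

/-- `N` is a parametrix of `Δ + λ²` that agrees with `theta` in the ball of radius `R` and is
supported in the ball of radius `2R`; `DN` is its gradient and `k` the smooth error. -/
structure IsParametrix (lam : ℂ) (R : ℝ) (N : R3 → ℂ) (DN : Fin 3 → R3 → ℂ) (k : R3 → ℂ) :
    Prop where
  integrable : Integrable N
  integrable_grad : ∀ i, Integrable (DN i)
  eq_theta : ∀ x, ‖x‖ < R → N x = theta lam x
  grad_eq : ∀ i x, ‖x‖ < R → DN i x = -vecE lam x i
  eq_zero : ∀ x, 2 * R < ‖x‖ → N x = 0
  err_eq_zero : ∀ x, ‖x‖ < R → k x = 0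
  err_eq_zero' : ∀ x, 2 * R < ‖x‖ → k x = 0
  err_smooth : ContDiff ℝ (⊤ : ℕ∞) k
  contDiffAt : ∀ x, x ≠ 0 → ContDiffAt ℝ (⊤ : ℕ∞) N x
  even : ∀ x, N (-x) = N x
  grad_odd : ∀ i x, DN i (-x) = -DN i x
  err_even : ∀ x, k (-x) = k x
  pair_pd : ∀ (φ : R3 → ℂ) (i : Fin 3), ContDiff ℝ (⊤ : ℕ∞) φ →
    pair N (pd i φ) = -pair (DN i) φ
  pair_helm : ∀ φ : R3 → ℂ, ContDiff ℝ (⊤ : ℕ∞) φ → pair N (helm lam φ) = φ 0 + pair k φ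

lemma exists_cutoff {R : ℝ} (hR : 0 < R) : ∃ η : R3 → ℂ, IsTest Set.univ η ∧
    (∀ x, η (-x) = η x) ∧ (∀ x, ‖x‖ < R → η x = 1) ∧ ∀ x, 2 * R < ‖x‖ → η x = 0 := by
  let χ : ContDiffBump (0 : R3) := ⟨R, 2 * R, hR, by linarith⟩
  refine ⟨fun x => (χ x : ℂ), ⟨Complex.ofRealCLM.contDiff.comp χ.contDiff,
    χ.hasCompactSupport.comp_left (g := Complex.ofReal) rfl, Set.subset_univ _⟩,
    fun x => by simp [χ.neg], fun x hx => ?_, fun x hx => ?_⟩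
  · simp [χ.one_of_mem_closedBall (mem_closedBall_zero_iff.2 hx.le)]
  · simp [χ.zero_of_le_dist (by simpa using hx.le)]

lemma pd_eq_zero_of_eventually {φ : R3 → ℂ} {c : ℂ} {x : R3} (h : ∀ᶠ y in 𝓝 x, φ y = c)
    (i : Fin 3) : ∀ᶠ y in 𝓝 x, pd i φ y = 0 := by
  filter_upwards [h.eventually_nhds] with y hy
  have : φ =ᶠ[𝓝 y] fun _ => c := hy
  simp [pd, this.fderiv_eq]

lemma pd_pd_mul {φ η : R3 → ℂ} (i : Fin 3) (hφ : ContDiff ℝ (⊤ : ℕ∞) φ)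
    (hη : ContDiff ℝ (⊤ : ℕ∞) η) (x : R3) :
    pd i (pd i (fun x => φ x * η x)) x =
      pd i (pd i φ) x * η x + 2 * (pd i φ x * pd i η x) + φ x * pd i (pd i η) x := by
  have d : ∀ {f : R3 → ℂ}, ContDiff ℝ (⊤ : ℕ∞) f → Differentiable ℝ f :=
    fun hf => hf.differentiable (by simp)
  have h1 := contDiff_pd i hφ
  have h2 := contDiff_pd i hη
  rw [pd_mul i (d hφ) (d hη), pd_add i (d (h1.mul hη)) (d (hφ.mul h2)), pd_mul i (d h1) (d hη),
    pd_mul i (d hφ) (d h2)]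
  ring

/-- Take N = ηθ with an even cutoff η. By the Leibniz rule (Δ + λ²)(ηθ) = δ + 2∇η·∇θ + (Δη)θ, and
the derivatives of η vanish near the origin, where θ is singular; so the error is smooth. Test
functions need no compact support here, because η supplies it. -/
theorem exists_isParametrix {lam : ℂ} (hlam : 0 ≤ lam.im) {R : ℝ} (hR : 0 < R) :
    ∃ N DN k, IsParametrix lam R N DN k := by
  obtain ⟨η, hη, hev, hone, hzero⟩ := exists_cutoff hR
  have hodd := pd_of_even hev
  have hev2 := fun i => pd_of_odd (hodd i) i
  have hone' : ∀ x, ‖x‖ < R → ∀ᶠ y in 𝓝 x, η y = 1 := fun x hx => by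
    filter_upwards [(isOpen_lt continuous_norm continuous_const).mem_nhds hx] with y hy
    exact hone y hy
  have hzero' : ∀ x, 2 * R < ‖x‖ → ∀ᶠ y in 𝓝 x, η y = 0 := fun x hx => by
    filter_upwards [(isOpen_lt continuous_const continuous_norm).mem_nhds hx] with y hy
    exact hzero y hy
  have hθ := (locallyIntegrable_theta hlam).locallyIntegrableOn Set.univ
  have hV := fun i => (locallyIntegrable_vecE hlam i).locallyIntegrableOn Set.univ
  set k : R3 → ℂ := fun x =>
    ∑ i, (pd i (pd i η) x * theta lam x - 2 * (pd i η x * vecE lam x i)) with hk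
  have hk0 : ∀ (x : R3) (c : ℂ), (∀ᶠ y in 𝓝 x, η y = c) → ∀ᶠ y in 𝓝 x, k y = 0 := by
    intro x c hc
    have h1 := fun i => pd_eq_zero_of_eventually hc i
    have h2 := fun i => pd_eq_zero_of_eventually (h1 i) i
    filter_upwards [eventually_all.2 h1, eventually_all.2 h2] with y hy1 hy2
    simp [hk, hy1, hy2]
  refine ⟨fun x => η x * theta lam x, fun i x => pd i η x * theta lam x - η x * vecE lam x i, k,
    ⟨hη.integrable_mul hθ, fun i => ((hη.pd i).integrable_mul hθ).sub (hη.integrable_mul (hV i)),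
      fun x hx => by simp [hone x hx], fun i x hx => ?_, fun x hx => by simp [hzero x hx],
      fun x hx => (hk0 x 1 (hone' x hx)).self_of_nhds,
      fun x hx => (hk0 x 0 (hzero' x hx)).self_of_nhds, ?_, fun x hx => ?_,
      fun x => by simp [hev, theta_neg], fun i x => ?_, fun x => ?_, fun φ i hφ => ?_,
      fun φ hφ => ?_⟩⟩
  · have := (pd_eq_zero_of_eventually (hone' x hx) i).self_of_nhds
    simp [this, hone x hx]
  · refine contDiff_iff_contDiffAt.2 fun x => ?_
    rcases eq_or_ne x 0 with rfl | hx
    · have : k =ᶠ[𝓝 0] fun _ => (0 : ℂ) := hk0 0 1 (hone' 0 (by simpa using hR))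
      exact contDiffAt_const.congr_of_eventuallyEq this
    · refine ContDiffAt.sum fun i _ => ?_
      exact (((hη.pd i).pd i).smooth.contDiffAt.mul (contDiffAt_theta lam hx)).sub
        (contDiffAt_const.mul ((hη.pd i).smooth.contDiffAt.mul (contDiffAt_vecE lam i hx)))
  · exact hη.smooth.contDiffAt.mul (contDiffAt_theta lam hx)
  · simp only [hodd, theta_neg, hev, vecE_neg]
    ring
  · simp only [hk, hodd, theta_neg, hev2, vecE_neg]
    refine Finset.sum_congr rfl fun i _ => ?_
    ring
  · have t1 := hη.mul_left hφ
    have t2 := hη.mul_left (contDiff_pd i hφ)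
    have t3 := (hη.pd i).mul_left hφ
    have h1 := pair_theta_pd hlam t1 i
    rw [pd_mul i (hφ.differentiable (by simp)) hη.differentiable, pair_add_right t2 t3 hθ] at h1
    have e1 : pair (fun x => η x * theta lam x) (pd i φ)
        = pair (theta lam) (fun x => pd i φ x * η x) := by simp [pair, mul_assoc]
    have e2 : pair (fun x => pd i η x * theta lam x - η x * vecE lam x i) φ
        = pair (theta lam) (fun x => φ x * pd i η x) -
          pair (fun x => vecE lam x i) (fun x => φ x * η x) := by
      simp only [pair]
      rw [← integral_sub (t3.integrable_mul hθ) (t1.integrable_mul (hV i))]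
      congr 1
      funext x
      ring
    rw [e1, e2]
    linear_combination h1
  · have t1 := hη.mul_left hφ
    have t3 := fun i => (hη.pd i).mul_left hφ
    have t4 := fun i => (hη.pd i).mul_left (contDiff_pd i hφ)
    have t5 := fun i => ((hη.pd i).pd i).mul_left hφ
    have t6 := fun i => hη.mul_left (contDiff_pd i (contDiff_pd i hφ))
    -- The Leibniz rule for ∂ᵢ∂ᵢ(φη), solved for the term with both derivatives on φ. The mixed term
    -- is rewritten by the weak gradient of θ tested with φ ∂ᵢη.
    have h1 : ∀ i, pair (theta lam) (fun x => pd i (pd i φ) x * η x) =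
        pair (theta lam) (pd i (pd i fun x => φ x * η x))
        - 2 * pair (fun x => vecE lam x i) (fun x => φ x * pd i η x)
        + pair (theta lam) (fun x => φ x * pd i (pd i η) x) := by
      intro i
      have a1 := pair_theta_pd hlam (t3 i) i
      rw [pd_mul i (hφ.differentiable (by simp)) (hη.pd i).differentiable,
        pair_add_right (t4 i) (t5 i) hθ] at a1
      rw [funext (pd_pd_mul i hφ hη.smooth),
        pair_add_right ((t6 i).add ((t4 i).const_mul 2)) (t5 i) hθ,
        pair_add_right (t6 i) ((t4 i).const_mul 2) hθ, pair_const_mul_right]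
      linear_combination -2 * a1
    have h2 := pair_theta_helm hlam t1
    rw [pair_helm t1 hθ, hone 0 (by simpa using hR), mul_one] at h2
    have e1 : pair (fun x => η x * theta lam x) (helm lam φ)
        = pair (theta lam) (fun x => pd 0 (pd 0 φ) x * η x)
          + pair (theta lam) (fun x => pd 1 (pd 1 φ) x * η x)
          + pair (theta lam) (fun x => pd 2 (pd 2 φ) x * η x)
          + lam ^ 2 * pair (theta lam) (fun x => φ x * η x) := by
      rw [← pair_const_mul_right, ← pair_add_right (t6 0) (t6 1) hθ,
        ← pair_add_right ((t6 0).add (t6 1)) (t6 2) hθ,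
        ← pair_add_right (((t6 0).add (t6 1)).add (t6 2)) (t1.const_mul _) hθ]
      simp only [pair, helm, Fin.sum_univ_three]
      congr 1
      funext x
      ring
    have e2 : pair k φ = ∑ i, (pair (theta lam) (fun x => φ x * pd i (pd i η) x)
        - 2 * pair (fun x => vecE lam x i) (fun x => φ x * pd i η x)) := by
      have : ∀ i, pair (theta lam) (fun x => φ x * pd i (pd i η) x)
        - 2 * pair (fun x => vecE lam x i) (fun x => φ x * pd i η x) =
          ∫ x, φ x * (pd i (pd i η) x * theta lam x - 2 * (pd i η x * vecE lam x i)) := by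
        intro i
        simp only [pair, ← integral_const_mul]
        rw [← integral_sub ((t5 i).integrable_mul hθ) (((t3 i).integrable_mul (hV i)).const_mul 2)]
        congr 1
        funext x
        ring
      simp only [this]
      rw [← integral_finsetSum]
      · simp only [pair, hk, Finset.mul_sum]
      · intro i _
        refine (((t5 i).integrable_mul hθ).sub
          (((t3 i).integrable_mul (hV i)).const_mul 2)).congr (Eventually.of_forall fun x => ?_)
        simp only [Pi.sub_apply]
        ring
    rw [e1, e2, h1, h1, h1, Fin.sum_univ_three]
    linear_combination h2

namespace IsParametrix

variable {lam : ℂ} {R : ℝ} {N k : R3 → ℂ} {DN : Fin 3 → R3 → ℂ}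

lemma hasCompactSupport (h : IsParametrix lam R N DN k) : HasCompactSupport N :=
  HasCompactSupport.of_support_subset_isCompact (isCompact_closedBall 0 (2 * R)) fun x hx => by
    rw [mem_closedBall_zero_iff]
    by_contra hx'
    exact hx (h.eq_zero x (not_le.1 hx'))

lemma err_hasCompactSupport (h : IsParametrix lam R N DN k) : HasCompactSupport k :=
  HasCompactSupport.of_support_subset_isCompact (isCompact_closedBall 0 (2 * R)) fun x hx => by
    rw [mem_closedBall_zero_iff]
    by_contra hx'
    exact hx (h.err_eq_zero' x (not_le.1 hx'))

lemma err_isTest (h : IsParametrix lam R N DN k) : IsTest Set.univ k :=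
  ⟨h.err_smooth, h.err_hasCompactSupport, Set.subset_univ _⟩

/-- The difference of two parametrices is smooth. -/
lemma sub_isTest {R' : ℝ} {N' k' : R3 → ℂ} {DN' : Fin 3 → R3 → ℂ} (hR : 0 < R) (hR' : 0 < R')
    (h : IsParametrix lam R N DN k) (h' : IsParametrix lam R' N' DN' k') :
    IsTest Set.univ fun x => N x - N' x := by
  refine ⟨contDiff_iff_contDiffAt.2 fun x => ?_, h.hasCompactSupport.sub h'.hasCompactSupport,
    Set.subset_univ _⟩
  rcases eq_or_ne x 0 with rfl | hx
  · have : (fun x => N x - N' x) =ᶠ[𝓝 0] fun _ => (0 : ℂ) := by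
      filter_upwards [Metric.ball_mem_nhds 0 hR, Metric.ball_mem_nhds 0 hR'] with y hy hy'
      rw [h.eq_theta y (by simpa using hy), h'.eq_theta y (by simpa using hy'), sub_self]
    exact contDiffAt_const.congr_of_eventuallyEq this
  · exact (h.contDiffAt x hx).sub (h'.contDiffAt x hx)

end IsParametrix

/-! ### Convolution operators -/

/-- The convolution `∫ N(x - y) f(y) dy`. -/
def conv (N f : R3 → ℂ) (x : R3) : ℂ := ∫ y, N (x - y) * f y

section conv

variable {N f φ : R3 → ℂ}

lemma conv_eq_convolution (N f : R3 → ℂ) :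
    conv N f = convolution N f (ContinuousLinearMap.mul ℝ ℂ) volume := by
  funext x
  rw [convolution_eq_swap]
  rfl

lemma conv_comm (N f : R3 → ℂ) : conv N f = conv f N := by
  rw [conv_eq_convolution N f]
  funext x
  simp [convolution_def, conv, mul_comm]

lemma integrable_conv_integrand (hN : Integrable N) (hf : Integrable f) :
    Integrable (fun z : R3 × R3 => N (z.1 - z.2) * f z.2) (volume.prod volume) := by
  have := hf.convolution_integrand (ContinuousLinearMap.mul ℝ ℂ) hN
  simpa [mul_comm] using this

lemma ae_integrable_conv (hN : Integrable N) (hf : Integrable f) :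
    ∀ᵐ x : R3, Integrable fun y => N (x - y) * f y :=
  (integrable_conv_integrand hN hf).prod_right_ae

lemma integrable_conv (hN : Integrable N) (hf : Integrable f) : Integrable (conv N f) :=
  (integrable_conv_integrand hN hf).integral_prod_left

/-- Young's inequality, qualitatively: convolution with an integrable kernel preserves `L^p`. -/
theorem memLp_conv {p : ℝ≥0∞} (hp : 1 < p) (hp_top : p < ⊤) (hN : Integrable N)
    (hf : Integrable f) (hfp : MemLp f p) : MemLp (conv N f) p := by
  refine ⟨(integrable_conv hN hf).aestronglyMeasurable, ?_⟩
  have hp0 : p ≠ 0 := (zero_lt_one.trans hp).ne'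
  rw [eLpNorm_lt_top_iff_lintegral_rpow_enorm_lt_top hp0 hp_top.ne]
  have hfin := (eLpNorm_lt_top_iff_lintegral_rpow_enorm_lt_top hp0 hp_top.ne).1 hfp.2
  set r := p.toReal with hr
  have hr1 : 1 < r := by
    rw [hr, ← ENNReal.toReal_one]
    exact (ENNReal.toReal_lt_toReal ENNReal.one_ne_top hp_top.ne).2 hp
  have hr0 : 0 < r := by linarith
  have hc := (Real.HolderConjugate.conjExponent hr1).symm
  set s := r.conjExponent with hs
  have hs0 : 0 < s := hc.pos
  set M : ℝ≥0∞ := ∫⁻ y, ‖N y‖ₑ with hM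
  have hMfin : M < ⊤ := hN.2
  have hmeas : ∀ x : R3, AEMeasurable fun y => ‖N (x - y)‖ₑ := fun x =>
    (hN.1.comp_quasiMeasurePreserving (quasiMeasurePreserving_sub_left volume x)).enorm
  have hmass : ∀ x : R3, ∫⁻ y, ‖N (x - y)‖ₑ = M := fun x =>
    lintegral_sub_left_eq_self (fun y => ‖N y‖ₑ) x
  have hpt : ∀ x, ‖conv N f x‖ₑ ^ r ≤ M ^ (r / s) * ∫⁻ y, ‖N (x - y)‖ₑ * ‖f y‖ₑ ^ r := by
    intro x
    have h1 : ‖conv N f x‖ₑ ≤ ∫⁻ y, ‖N (x - y)‖ₑ * ‖f y‖ₑ := by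
      refine (enorm_integral_le_lintegral_enorm _).trans (le_of_eq ?_)
      simp only [enorm_mul]
    -- Hölder's inequality after splitting |N| = |N|^(1/s) |N|^(1/r), with |f| attached to the
    -- second factor.
    have h2 := ENNReal.lintegral_mul_le_Lp_mul_Lq volume hc
      ((hmeas x).pow_const (1 / s)) (((hmeas x).pow_const (1 / r)).mul hf.1.enorm)
    have h3 : ∀ y, ((fun y => ‖N (x - y)‖ₑ ^ (1 / s)) *
        ((fun y => ‖N (x - y)‖ₑ ^ (1 / r)) * fun y => ‖f y‖ₑ)) y = ‖N (x - y)‖ₑ * ‖f y‖ₑ := by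
      intro y
      simp only [Pi.mul_apply]
      rw [← mul_assoc, ← ENNReal.rpow_add_of_nonneg _ _ (by positivity) (by positivity)]
      have : 1 / s + 1 / r = 1 := by simpa using hc.inv_add_inv_eq_one
      rw [this, ENNReal.rpow_one]
    have h4 : ∀ y, (‖N (x - y)‖ₑ ^ (1 / s)) ^ s = ‖N (x - y)‖ₑ := fun y => by
      rw [← ENNReal.rpow_mul, one_div_mul_cancel hs0.ne', ENNReal.rpow_one]
    have h5 : ∀ y, (((fun y => ‖N (x - y)‖ₑ ^ (1 / r)) * fun y => ‖f y‖ₑ) y) ^ r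
        = ‖N (x - y)‖ₑ * ‖f y‖ₑ ^ r := fun y => by
      simp only [Pi.mul_apply]
      rw [ENNReal.mul_rpow_of_nonneg _ _ hr0.le, ← ENNReal.rpow_mul,
        one_div_mul_cancel hr0.ne', ENNReal.rpow_one]
    simp only [h3, h4, h5, hmass] at h2
    calc ‖conv N f x‖ₑ ^ r
        ≤ (M ^ (1 / s) * (∫⁻ y, ‖N (x - y)‖ₑ * ‖f y‖ₑ ^ r) ^ (1 / r)) ^ r := by
          gcongr
          exact h1.trans h2
      _ = _ := by
          rw [ENNReal.mul_rpow_of_nonneg _ _ hr0.le, ← ENNReal.rpow_mul, ← ENNReal.rpow_mul,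
            one_div_mul_cancel hr0.ne', ENNReal.rpow_one]
          congr 2
          ring
  have hjoint : AEMeasurable (fun z : R3 × R3 => ‖N (z.1 - z.2)‖ₑ * ‖f z.2‖ₑ ^ r)
      (volume.prod volume) := by
    refine AEMeasurable.mul ?_ ?_
    · exact (hN.1.comp_quasiMeasurePreserving
        (quasiMeasurePreserving_sub_of_right_invariant volume volume)).enorm
    · exact (hf.1.comp_snd.enorm).pow_const r
  -- By Tonelli, integrating in x first yields a second factor of the mass M.
  calc ∫⁻ x, ‖conv N f x‖ₑ ^ r
      ≤ ∫⁻ x, M ^ (r / s) * ∫⁻ y, ‖N (x - y)‖ₑ * ‖f y‖ₑ ^ r := lintegral_mono hpt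
    _ = M ^ (r / s) * ∫⁻ x, ∫⁻ y, ‖N (x - y)‖ₑ * ‖f y‖ₑ ^ r :=
        lintegral_const_mul' _ _ (ENNReal.rpow_lt_top_of_nonneg (by positivity) hMfin.ne).ne
    _ = M ^ (r / s) * ∫⁻ y, M * ‖f y‖ₑ ^ r := by
        rw [lintegral_lintegral_swap hjoint]
        congr 2
        funext y
        have hm : AEMeasurable fun x => ‖N (x - y)‖ₑ :=
          (hN.1.comp_quasiMeasurePreserving
            (measurePreserving_sub_right volume y).quasiMeasurePreserving).enorm
        rw [lintegral_mul_const'' _ hm, lintegral_sub_right_eq_self (fun x => ‖N x‖ₑ) y]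
    _ < ⊤ := by
        rw [lintegral_const_mul' _ _ hMfin.ne]
        exact ENNReal.mul_lt_top (ENNReal.rpow_lt_top_of_nonneg (by positivity) hMfin.ne)
          (ENNReal.mul_lt_top hMfin hfin)

/-- Fubini: the transpose of a convolution operator has the reflected kernel. This is why
parametrices carry parity information. -/
lemma pair_conv {Ω : Set R3} (hφ : IsTest Ω φ) (hN : Integrable N) (hf : Integrable f) :
    pair (conv N f) φ = pair f (conv (fun x => N (-x)) φ) := by
  obtain ⟨C, hC⟩ := hφ.exists_bound
  have hI : Integrable (Function.uncurry fun x y : R3 => φ x * (N (x - y) * f y))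
      (volume.prod volume) :=
    (integrable_conv_integrand hN hf).bdd_mul (c := C)
      (hφ.continuous.comp continuous_fst).aestronglyMeasurable
      (Eventually.of_forall fun z => hC z.1)
  have h := integral_integral_swap hI
  simp only [pair, conv, ← integral_const_mul, ← integral_mul_const, neg_sub]
  rw [h]
  congr 1
  funext y
  congr 1
  funext x
  ring

lemma pair_conv_of_even {Ω : Set R3} (hφ : IsTest Ω φ) (hN : Integrable N) (hf : Integrable f)
    (h : ∀ x, N (-x) = N x) : pair (conv N f) φ = pair f (conv N φ) := by
  rw [pair_conv hφ hN hf, funext h]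

lemma pair_conv_of_odd {Ω : Set R3} (hφ : IsTest Ω φ) (hN : Integrable N) (hf : Integrable f)
    (h : ∀ x, N (-x) = -N x) : pair (conv N f) φ = -pair f (conv N φ) := by
  rw [pair_conv hφ hN hf, funext h]
  simp [pair, conv, integral_neg]

lemma conv_eq_pair (N φ : R3 → ℂ) (x : R3) : conv N φ x = pair N fun y => φ (x - y) := by
  rw [conv_comm]
  rfl

lemma contDiff_conv {Ω : Set R3} (hφ : IsTest Ω φ) (hN : LocallyIntegrable N) :
    ContDiff ℝ (⊤ : ℕ∞) (conv N φ) := by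
  rw [conv_eq_convolution]
  exact hφ.compact.contDiff_convolution_right _ hN hφ.smooth

lemma pd_conv {Ω : Set R3} (hφ : IsTest Ω φ) (hN : LocallyIntegrable N) (i : Fin 3) :
    pd i (conv N φ) = conv N (pd i φ) := by
  funext x
  have hs : ContDiff ℝ 1 φ := hφ.smooth.of_le (by simp)
  rw [conv_eq_convolution, pd, (hφ.compact.hasFDerivAt_convolution_right _ hN hs x).fderiv,
    convolution_precompR_apply _ hN (hφ.compact.fderiv ℝ) (hs.continuous_fderiv one_ne_zero),
    conv_eq_convolution]
  rfl

lemma support_conv_subset {r : ℝ} (hN : ∀ x, r < ‖x‖ → N x = 0) :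
    Function.support (conv N φ) ⊆ Metric.cthickening r (tsupport φ) := by
  intro x hx
  by_contra hx'
  refine hx (integral_eq_zero_of_ae (Eventually.of_forall fun y => ?_))
  by_cases hy : y ∈ tsupport φ
  · have : r < ‖x - y‖ := by
      rw [← dist_eq_norm]
      by_contra h
      exact hx' (Metric.mem_cthickening_of_dist_le x y r _ hy (not_lt.1 h))
    simp [hN _ this]
  · simp [image_eq_zero_of_notMem_tsupport hy]

/-- A kernel of range r enlarges supports by at most r. Hence a convolved test function may itself
be inserted into a weak equation, which θ with its unbounded support would not allow. -/
lemma IsTest.conv {Ω U : Set R3} (hφ : IsTest Ω φ) (hN : LocallyIntegrable N) {r : ℝ}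
    (hNr : ∀ x, r < ‖x‖ → N x = 0) (hU : Metric.cthickening r (tsupport φ) ⊆ U) :
    IsTest U (conv N φ) := by
  have h := closure_minimal (support_conv_subset (φ := φ) hNr) Metric.isClosed_cthickening
  refine ⟨contDiff_conv hφ hN, ?_, h.trans hU⟩
  exact (hφ.compact.isCompact.cthickening (r := r)).of_isClosed_subset isClosed_closure h

end conv

/-! ### Convolution with a parametrix -/

lemma pd_comp_sub_left (φ : R3 → ℂ) (i : Fin 3) (x : R3) :
    pd i (fun y => φ (x - y)) = fun y => -pd i φ (x - y) := by
  funext y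
  have h1 := pd_comp_neg (fun z => φ (x + z)) i y
  have h2 : pd i (fun z => φ (x + z)) (-y) = pd i φ (x - y) := by
    rw [pd, fderiv_comp_add_left]
    rfl
  rw [← h2, ← h1]
  simp only [sub_eq_add_neg]

namespace IsParametrix

variable {lam : ℂ} {R : ℝ} {N k φ : R3 → ℂ} {DN : Fin 3 → R3 → ℂ}

/-- The weak gradient of N is tested against y ↦ φ(x - y); the reflection cancels the sign. -/
lemma conv_pd (h : IsParametrix lam R N DN k) {Ω : Set R3} (hφ : IsTest Ω φ) (i : Fin 3) :
    conv N (pd i φ) = conv (DN i) φ := by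
  funext x
  have hs : ContDiff ℝ (⊤ : ℕ∞) fun y => φ (x - y) :=
    hφ.smooth.comp (contDiff_const.sub contDiff_id)
  have h1 := h.pair_pd _ i hs
  rw [pd_comp_sub_left] at h1
  rw [conv_eq_pair, conv_eq_pair]
  simp only [pair, neg_mul, integral_neg, neg_inj] at h1 ⊢
  exact h1

/-- The defining identity of the parametrix, tested against y ↦ φ(x - y), on which Δ + λ² acts
without change of sign. -/
lemma conv_helm (h : IsParametrix lam R N DN k) {Ω : Set R3} (hφ : IsTest Ω φ) :
    conv N (helm lam φ) = fun x => φ x + conv k φ x := by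
  funext x
  have hs : ContDiff ℝ (⊤ : ℕ∞) fun y => φ (x - y) :=
    hφ.smooth.comp (contDiff_const.sub contDiff_id)
  have h1 := h.pair_helm _ hs
  have h2 : helm lam (fun y => φ (x - y)) = fun y => helm lam φ (x - y) := by
    have h3 : ∀ i, pd i (pd i fun y => φ (x - y)) = fun y => pd i (pd i φ) (x - y) := by
      intro i
      have h4 := pd_comp_sub_left (pd i φ) i x
      rw [pd_comp_sub_left]
      funext y
      have h5 : pd i (fun y => -pd i φ (x - y)) y = -pd i (fun y => pd i φ (x - y)) y := by
        simp [pd, fderiv_fun_neg]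
      rw [h5, h4, neg_neg]
    funext y
    simp only [helm, h3]
  rw [h2, sub_zero] at h1
  rw [conv_eq_pair, conv_eq_pair, h1]

lemma pair_conv_pd (h : IsParametrix lam R N DN k) {Ω : Set R3} (hφ : IsTest Ω φ) {f : R3 → ℂ}
    (hf : Integrable f) (i : Fin 3) :
    pair (conv (DN i) f) φ = -pair (conv N f) (pd i φ) := by
  rw [pair_conv_of_odd hφ (h.integrable_grad i) hf (h.grad_odd i),
    pair_conv_of_even (hφ.pd i) h.integrable hf h.even, h.conv_pd hφ]

end IsParametrix

section

/-! ### Weyl's lemma for the Helmholtz equation -/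

section

variable {N φ : R3 → ℂ}

lemma IsTest.comp_sub_left {Ω : Set R3} (hφ : IsTest Ω φ) (x : R3) :
    IsTest Set.univ fun y => φ (x - y) := by
  refine ⟨hφ.smooth.comp (contDiff_const.sub contDiff_id), ?_, Set.subset_univ _⟩
  exact hφ.compact.comp_homeomorph (Homeomorph.subLeft x)

lemma conv_add_right {Ω U : Set R3} {ψ : R3 → ℂ} (hφ : IsTest Ω φ) (hψ : IsTest U ψ)
    (hN : LocallyIntegrable N) (x : R3) :
    conv N (fun y => φ y + ψ y) x = conv N φ x + conv N ψ x := by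
  simp only [conv_eq_pair]
  exact pair_add_right (hφ.comp_sub_left x) (hψ.comp_sub_left x) (hN.locallyIntegrableOn _)

lemma conv_const_mul_right (c : ℂ) (x : R3) :
    conv N (fun y => c * φ y) x = c * conv N φ x := by
  simp only [conv_eq_pair, pair_const_mul_right]

lemma helm_conv {Ω : Set R3} (hφ : IsTest Ω φ) (hN : LocallyIntegrable N) (lam : ℂ) :
    helm lam (conv N φ) = conv N (helm lam φ) := by
  have h := fun i => (hφ.pd i).pd i
  funext x
  rw [helm_eq lam φ, conv_add_right (((h 0).add (h 1)).add (h 2)) (hφ.const_mul _) hN,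
    conv_add_right ((h 0).add (h 1)) (h 2) hN, conv_add_right (h 0) (h 1) hN,
    conv_const_mul_right]
  simp only [helm, Fin.sum_univ_three, pd_conv hφ hN, pd_conv (hφ.pd _) hN]

end

variable {lam : ℂ} {Ω : Set R3} {w : R3 → ℂ}

/-- Testing the equation with N * φ gives 0 = ⟨w, φ⟩ + ⟨w, k * φ⟩. Thus w = -k * w near `x₀`, with w
truncated to a compact ball, and the right side is smooth because k is. -/
lemma exists_smooth_rep_ball (hlam : 0 ≤ lam.im) (hw : LocallyIntegrableOn w Ω)
    (h : ∀ φ, IsTest Ω φ → pair w (helm lam φ) = 0) {x₀ : R3} {r : ℝ} (hr : 0 < r)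
    (hball : Metric.closedBall x₀ (4 * r) ⊆ Ω) :
    ∃ u : R3 → ℂ, ContDiff ℝ (⊤ : ℕ∞) u ∧ w =ᵐ[volume.restrict (Metric.ball x₀ r)] u := by
  obtain ⟨N, DN, k, hN⟩ := exists_isParametrix hlam hr
  set K := Metric.closedBall x₀ (4 * r) with hK
  have hKc : IsCompact K := isCompact_closedBall _ _
  have hKm : MeasurableSet K := hKc.measurableSet
  set w' := K.indicator w with hw'
  have hwi : Integrable w' :=
    (integrable_indicator_iff hKm).2 (hw.integrableOn_compact_subset hball hKc)
  have hNl := hN.integrable.locallyIntegrable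
  have hkl := hN.err_isTest.integrable.locallyIntegrable
  have hcont : ContDiff ℝ (⊤ : ℕ∞) (conv k w') := by
    rw [conv_comm]
    exact contDiff_conv hN.err_isTest hwi.locallyIntegrable
  refine ⟨fun x => (-1) * conv k w' x, contDiff_const.mul hcont, ?_⟩
  have hsub : Metric.ball x₀ r ⊆ Ω :=
    (Metric.ball_subset_closedBall.trans (Metric.closedBall_subset_closedBall (by linarith))).trans
      hball
  refine ae_eq_of_pair_eq Metric.isOpen_ball (hw.mono_set hsub)
    ((contDiff_const.mul hcont).continuous.locallyIntegrable.locallyIntegrableOn _) fun φ hφ => ?_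
  -- Range 2r starting from a ball of radius r stays within 3r, inside the closed ball of radius 4r.
  have hthick : Metric.cthickening (2 * r) (tsupport φ) ⊆ K := by
    refine (Metric.cthickening_subset_of_subset _ hφ.subset).trans ?_
    rw [cthickening_ball (by positivity) hr]
    exact Metric.closedBall_subset_closedBall (by linarith)
  have h1 : IsTest Ω (conv N φ) := hφ.conv hNl hN.eq_zero (hthick.trans hball)
  have h2 : IsTest K (conv k φ) := hφ.conv hkl hN.err_eq_zero' hthick
  have h3 := h _ h1
  rw [helm_conv hφ hNl, hN.conv_helm hφ,
    pair_add_right (hφ.mono hsub) (h2.mono hball) hw] at h3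
  have h4 : pair w (conv k φ) = pair w' (conv k φ) :=
    pair_congr h2 (indicator_ae_eq_restrict hKm).symm
  rw [pair_const_mul_left,
    pair_conv_of_even hφ hN.err_isTest.integrable hwi hN.err_even, ← h4]
  linear_combination h3

/-- Weyl's lemma: a locally integrable distributional solution of the Helmholtz equation is almost
everywhere equal to a smooth function. -/
theorem exists_smooth_rep (hlam : 0 ≤ lam.im) (hΩ : IsOpen Ω) (hw : LocallyIntegrableOn w Ω)
    (h : ∀ φ, IsTest Ω φ → pair w (helm lam φ) = 0) :
    ∃ u : R3 → ℂ, ContDiffOn ℝ (⊤ : ℕ∞) u Ω ∧ w =ᵐ[volume.restrict Ω] u := by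
  have hex : ∀ x ∈ Ω, ∃ r > 0, ∃ u : R3 → ℂ, ContDiff ℝ (⊤ : ℕ∞) u ∧
      w =ᵐ[volume.restrict (Metric.ball x r)] u := by
    intro x hx
    obtain ⟨s, hs, hsub⟩ := Metric.nhds_basis_closedBall.mem_iff.1 (hΩ.mem_nhds hx)
    obtain ⟨u, hu⟩ := exists_smooth_rep_ball hlam hw h (r := s / 4) (by positivity)
      (by rwa [mul_div_cancel₀ s four_ne_zero])
    exact ⟨s / 4, by positivity, u, hu⟩
  choose! r hr v hv hwv using hex
  -- Local representatives agree a.e. on overlaps, hence everywhere there by continuity. So the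
  -- diagonal choice x ↦ `v x x` is locally one of them.
  have hagree : ∀ x ∈ Ω, ∀ y ∈ Ω, y ∈ Metric.ball x (r x) → v y y = v x y := by
    intro x hx y hy hyx
    have hopen : IsOpen (Metric.ball x (r x) ∩ Metric.ball y (r y)) :=
      Metric.isOpen_ball.inter Metric.isOpen_ball
    have h1 : w =ᵐ[volume.restrict (Metric.ball x (r x) ∩ Metric.ball y (r y))] v x :=
      ae_restrict_of_ae_restrict_of_subset Set.inter_subset_left (hwv x hx)
    have h2 : w =ᵐ[volume.restrict (Metric.ball x (r x) ∩ Metric.ball y (r y))] v y :=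
      ae_restrict_of_ae_restrict_of_subset Set.inter_subset_right (hwv y hy)
    have hae := h2.symm.trans h1
    exact Measure.eqOn_open_of_ae_eq hae hopen (hv y hy).continuous.continuousOn
      (hv x hx).continuous.continuousOn ⟨hyx, Metric.mem_ball_self (hr y hy)⟩
  refine ⟨fun x => v x x, fun x hx => ?_, ?_⟩
  · refine ((hv x hx).contDiffAt.congr_of_eventuallyEq ?_).contDiffWithinAt
    filter_upwards [hΩ.mem_nhds hx, Metric.ball_mem_nhds x (hr x hx)] with y hy hyx
    exact hagree x hx y hy hyx
  · rw [EventuallyEq, ae_restrict_iff' hΩ.measurableSet, ae_iff]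
    refine measure_null_of_locally_null _ fun x hx => ?_
    have hxΩ : x ∈ Ω := by
      by_contra hx'
      exact hx fun h => absurd h hx'
    refine ⟨_, inter_mem_nhdsWithin _ (Metric.ball_mem_nhds x (hr x hxΩ)), ?_⟩
    have h1 := hwv x hxΩ
    rw [EventuallyEq, ae_restrict_iff' Metric.isOpen_ball.measurableSet, ae_iff] at h1
    refine measure_mono_null ?_ h1
    rintro y ⟨hy, hyx⟩ hy'
    exact hy fun hyΩ => (hy' hyx).trans (hagree x hxΩ y hyΩ hyx).symm

end

section

/-! ### Exhaustion of a domain and patching of local representatives -/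

/-- The points of `Ω` at distance more than `1 / (n + 1)` from the complement. -/
def innerSet (Ω : Set R3) (n : ℕ) : Set R3 := {x | 1 / ((n : ℝ) + 1) < Metric.infDist x Ωᶜ}

section innerSet

variable {Ω : Set R3}

lemma isOpen_innerSet (Ω : Set R3) (n : ℕ) : IsOpen (innerSet Ω n) :=
  isOpen_lt continuous_const (Metric.continuous_infDist_pt _)

lemma mem_of_infDist_pos {x : R3} (hx : 0 < Metric.infDist x Ωᶜ) : x ∈ Ω := by
  by_contra h
  rw [Metric.infDist_zero_of_mem (show x ∈ Ωᶜ from h)] at hx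
  exact lt_irrefl _ hx

lemma innerSet_mono (Ω : Set R3) : Monotone (innerSet Ω) := fun _ _ hnm _ hx =>
  (Nat.one_div_le_one_div (α := ℝ) hnm).trans_lt (id hx : _ < _)

lemma exists_subset_innerSet (hΩ : IsOpen Ω) (hne : Ωᶜ.Nonempty) {K : Set R3} (hK : IsCompact K)
    (hKΩ : K ⊆ Ω) : ∃ n, K ⊆ innerSet Ω n := by
  refine hK.elim_directed_cover _ (isOpen_innerSet Ω) (fun x hx => ?_)
    (innerSet_mono Ω).directed_le
  have : 0 < Metric.infDist x Ωᶜ :=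
    (hΩ.isClosed_compl.notMem_iff_infDist_pos hne).1 fun h => h (hKΩ hx)
  obtain ⟨n, hn⟩ := exists_nat_one_div_lt this
  exact Set.mem_iUnion.2 ⟨n, hn⟩

lemma cthickening_subset_of_subset_innerSet {n : ℕ} {K : Set R3} (hK : IsCompact K)
    (hKn : K ⊆ innerSet Ω n) {r : ℝ} (hr0 : 0 ≤ r) (hr : r ≤ 1 / ((n : ℝ) + 1)) :
    Metric.cthickening r K ⊆ Ω := by
  rw [hK.cthickening_eq_biUnion_closedBall hr0]
  intro y hy
  obtain ⟨x, hx, hxy⟩ := Set.mem_iUnion₂.1 hy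
  refine mem_of_infDist_pos ?_
  have h1 : 1 / ((n : ℝ) + 1) < Metric.infDist x Ωᶜ := hKn hx
  have h2 := Metric.infDist_le_infDist_add_dist (s := Ωᶜ) (x := x) (y := y)
  have h3 : dist x y ≤ r := by rw [dist_comm]; exact hxy
  linarith

lemma IsTest.exists_innerSet (hΩ : IsOpen Ω) (hne : Ωᶜ.Nonempty) {φ : R3 → ℂ}
    (hφ : IsTest Ω φ) : ∃ n, IsTest (innerSet Ω n) φ := by
  obtain ⟨n, hn⟩ := exists_subset_innerSet hΩ hne hφ.compact.isCompact hφ.subset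
  exact ⟨n, hφ.smooth, hφ.compact, hn⟩

-- The value at x is taken from the first set containing x. Only countably many a.e. identities are
-- involved, so the exceptional set is null.
open Classical in
lemma exists_patch {U : ℕ → Set R3} (hU : ∀ n, MeasurableSet (U n)) (F : ℕ → R3 → ℂ)
    (hF : ∀ m n, m ≤ n → F m =ᵐ[volume.restrict (U m)] F n) :
    ∃ f : R3 → ℂ, ∀ n, f =ᵐ[volume.restrict (U n)] F n := by
  refine ⟨fun x => if h : ∃ n, x ∈ U n then F (Nat.find h) x else 0, fun n => ?_⟩
  have h1 : ∀ᵐ x, ∀ m, m ≤ n → x ∈ U m → F m x = F n x := by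
    rw [ae_all_iff]
    intro m
    by_cases hm : m ≤ n
    · have := hF m n hm
      rw [EventuallyEq, ae_restrict_iff' (hU m)] at this
      filter_upwards [this] with x hx _ using hx
    · exact Eventually.of_forall fun x h => absurd h hm
  rw [EventuallyEq, ae_restrict_iff' (hU n)]
  filter_upwards [h1] with x hx hxn
  have hex : ∃ n, x ∈ U n := ⟨n, hxn⟩
  rw [dif_pos hex]
  exact hx _ (Nat.find_min' hex hxn) (Nat.find_spec hex)

end innerSet

/-! ### The gradient of the divergence of the volume potential -/

lemma IsTest.conv_pd {s φ : R3 → ℂ} {Ω U : Set R3} (hs : IsTest U s) (hφ : IsTest Ω φ)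
    (i : Fin 3) : MaxwellWeak.conv s (MaxwellWeak.pd i φ) = MaxwellWeak.conv (MaxwellWeak.pd i s) φ := by
  rw [← pd_conv hφ hs.integrable.locallyIntegrable, conv_comm s φ,
    pd_conv hs hφ.integrable.locallyIntegrable, conv_comm]

lemma pair_sum_left {Ω : Set R3} {φ : R3 → ℂ} {f : Fin 3 → R3 → ℂ} (hφ : IsTest Ω φ)
    (hf : ∀ l, LocallyIntegrableOn (f l) Ω) :
    pair (fun x => ∑ l, f l x) φ = ∑ l, pair (f l) φ := by
  simp only [pair, Finset.mul_sum]
  exact integral_finsetSum _ fun l _ => hφ.integrable_mul (hf l)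

lemma conv_sub_left {N N' φ : R3 → ℂ} {Ω : Set R3} (hφ : IsTest Ω φ) (hN : LocallyIntegrable N)
    (hN' : LocallyIntegrable N') (x : R3) :
    conv (fun y => N y - N' y) φ x = conv N φ x - conv N' φ x := by
  simp only [conv_eq_pair]
  exact pair_sub_left (hφ.comp_sub_left x) (hN.locallyIntegrableOn _) (hN'.locallyIntegrableOn _)

variable {lam : ℂ} {Ω : Set R3} {p : ℝ≥0∞} {j : Fin 3 → R3 → ℂ} {d N k : R3 → ℂ} {R : ℝ}
  {DN : Fin 3 → R3 → ℂ}

/-- Split N = M + s with M a parametrix of short range and s smooth. Derivatives on the s-part fall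
on s. For the M-part, M * ∂ᵢφ is still a test function in `Ω`, so the weak divergence of j applies
and leaves only the integrable kernel ∂ᵢM, convolved with `d`. -/
lemma exists_grad_div_innerSet (hlam : 0 ≤ lam.im) (hp : 1 < p) (hp_top : p < ⊤)
    (hj : ∀ i, Integrable (j i)) (hjp : ∀ i, MemLp (j i) p) (hd : Integrable d)
    (hdp : MemLp d p)
    (hdiv : ∀ φ, IsTest Ω φ → pair d φ = -∑ i, pair (j i) (pd i φ)) (hR : 0 < R)
    (hN : IsParametrix lam R N DN k) (n : ℕ) (i : Fin 3) :
    ∃ B : R3 → ℂ, Integrable B ∧ MemLp B p ∧ ∀ φ, IsTest (innerSet Ω n) φ →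
      pair B φ = ∑ l, pair (conv N (j l)) (pd l (pd i φ)) := by
  -- The range 2r of M is then exactly the margin 1/(n + 1) that defines `innerSet Ω n`.
  set r : ℝ := 1 / ((n : ℝ) + 1) / 2 with hr
  have hr0 : 0 < r := by positivity
  obtain ⟨M, DM, k', hM⟩ := exists_isParametrix hlam hr0
  have hs := hN.sub_isTest hR hr0 hM
  set s : R3 → ℂ := fun x => N x - M x with hs_def
  have hs_even : ∀ x, s (-x) = s x := fun x => by simp [hs_def, hN.even, hM.even]
  have hs2 := fun l => (hs.pd i).pd l
  have hs2_even : ∀ l x, pd l (pd i s) (-x) = pd l (pd i s) x := fun l =>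
    pd_of_odd (pd_of_even hs_even i) l
  have hMl := hM.integrable.locallyIntegrable
  refine ⟨fun x => conv (DM i) d x + ∑ l, conv (pd l (pd i s)) (j l) x,
    (integrable_conv (hM.integrable_grad i) hd).add
      (integrable_finsetSum _ fun l _ => integrable_conv (hs2 l).integrable (hj l)),
    (memLp_conv hp hp_top (hM.integrable_grad i) hd hdp).add
      (memLp_finsetSum _ fun l _ => memLp_conv hp hp_top (hs2 l).integrable (hj l) (hjp l)),
    fun φ hφ => ?_⟩
  have hint1 := integrable_conv (hM.integrable_grad i) hd
  have hint2 := fun l => integrable_conv (hs2 l).integrable (hj l)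
  have hψ : IsTest Ω (conv M (pd i φ)) := by
    refine (hφ.pd i).conv hMl hM.eq_zero
      (cthickening_subset_of_subset_innerSet (hφ.pd i).compact.isCompact (hφ.pd i).subset
        (by positivity) (le_of_eq ?_))
    rw [hr]; ring
  have h1 : pair (fun x => conv (DM i) d x + ∑ l, conv (pd l (pd i s)) (j l) x) φ =
      pair (conv (DM i) d) φ + ∑ l, pair (conv (pd l (pd i s)) (j l)) φ := by
    rw [pair_add_left hφ (hint1.locallyIntegrable.locallyIntegrableOn _)
      ((integrable_finsetSum _ fun l _ => hint2 l).locallyIntegrable.locallyIntegrableOn _),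
      pair_sum_left hφ fun l => (hint2 l).locallyIntegrable.locallyIntegrableOn _]
  have h2 : pair (conv (DM i) d) φ = ∑ l, pair (j l) (conv M (pd l (pd i φ))) := by
    rw [pair_conv_of_odd hφ (hM.integrable_grad i) hd (hM.grad_odd i), ← hM.conv_pd hφ,
      hdiv _ hψ, neg_neg]
    simp only [pd_conv (hφ.pd i) hMl]
  have h3 : ∀ l, pair (conv (pd l (pd i s)) (j l)) φ = pair (j l) (conv s (pd l (pd i φ))) := by
    intro l
    rw [pair_conv_of_even hφ (hs2 l).integrable (hj l) (hs2_even l), ← (hs.pd i).conv_pd hφ,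
      ← hs.conv_pd (hφ.pd l), pd_comm i l hφ.smooth]
  rw [h1, h2, ← Finset.sum_add_distrib]
  refine Finset.sum_congr rfl fun l _ => ?_
  have ht := (hφ.pd i).pd l
  rw [h3, pair_conv_of_even ht hN.integrable (hj l) hN.even]
  have e : conv N (pd l (pd i φ)) =
      fun x => conv M (pd l (pd i φ)) x + conv s (pd l (pd i φ)) x := by
    funext x
    rw [hs_def, conv_sub_left ht hN.integrable.locallyIntegrable hMl]
    ring
  have c1 := ht.conv (U := Set.univ) hMl hM.eq_zero (Set.subset_univ _)
  have c2 : IsTest Set.univ (conv s (pd l (pd i φ))) := by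
    refine ⟨contDiff_conv ht hs.integrable.locallyIntegrable, ?_, Set.subset_univ _⟩
    rw [conv_eq_convolution]
    exact hs.compact.convolution _ ht.compact
  rw [e, pair_add_right c1 c2 ((hj l).locallyIntegrable.locallyIntegrableOn _)]

/-- On each inner set the distribution ∂ᵢ div (N * j) is represented by a function in L^p. These
functions agree a.e. on the smaller inner sets because a distribution determines its representative,
so they can be patched. -/
theorem exists_grad_div (hΩ : IsOpen Ω) (hne : Ωᶜ.Nonempty) (hlam : 0 ≤ lam.im) (hp : 1 < p)
    (hp_top : p < ⊤) (hj : ∀ i, Integrable (j i)) (hjp : ∀ i, MemLp (j i) p)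
    (hd : Integrable d) (hdp : MemLp d p)
    (hdiv : ∀ φ, IsTest Ω φ → pair d φ = -∑ i, pair (j i) (pd i φ)) (hR : 0 < R)
    (hN : IsParametrix lam R N DN k) (i : Fin 3) :
    ∃ B : R3 → ℂ, (∀ K ⊆ Ω, IsCompact K → MemLp B p (volume.restrict K)) ∧
      ∀ φ, IsTest Ω φ → pair B φ = ∑ l, pair (conv N (j l)) (pd l (pd i φ)) := by
  choose F hF hFp hFpair using fun n =>
    exists_grad_div_innerSet hlam hp hp_top hj hjp hd hdp hdiv hR hN n i
  obtain ⟨B, hB⟩ := exists_patch (fun n => (isOpen_innerSet Ω n).measurableSet) F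
    fun m n hmn => ae_eq_of_pair_eq (isOpen_innerSet Ω m)
      ((hF m).locallyIntegrable.locallyIntegrableOn _)
      ((hF n).locallyIntegrable.locallyIntegrableOn _) fun φ hφ => by
        rw [hFpair m φ hφ, hFpair n φ (hφ.mono (innerSet_mono Ω hmn))]
  refine ⟨B, fun K hK hKc => ?_, fun φ hφ => ?_⟩
  · obtain ⟨n, hn⟩ := exists_subset_innerSet hΩ hne hKc hK
    have h : B =ᵐ[volume.restrict K] F n := ae_restrict_of_ae_restrict_of_subset hn (hB n)
    exact ((hFp n).restrict K).ae_eq h.symm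
  · obtain ⟨n, hn⟩ := hφ.exists_innerSet hΩ hne
    rw [pair_congr hn (hB n), hFpair n φ hn]

end

/-! ### Weak curl and divergence in components -/

/-- The `k`-th component of a vector field. -/
def comp (k : Fin 3) (F : R3 → C3) : R3 → ℂ := fun x => F x k

/-- All components of `F` are locally integrable on `Ω`. -/
def LocInt (Ω : Set R3) (F : R3 → C3) : Prop := ∀ k, LocallyIntegrableOn (comp k F) Ω

/-- `curl F = G` in the sense of distributions in `Ω`, in components. -/
structure IsCurl (Ω : Set R3) (F G : R3 → C3) : Prop where
  c0 : ∀ φ, IsTest Ω φ →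
    pair (comp 0 G) φ = pair (comp 1 F) (pd 2 φ) - pair (comp 2 F) (pd 1 φ)
  c1 : ∀ φ, IsTest Ω φ →
    pair (comp 1 G) φ = pair (comp 2 F) (pd 0 φ) - pair (comp 0 F) (pd 2 φ)
  c2 : ∀ φ, IsTest Ω φ →
    pair (comp 2 G) φ = pair (comp 0 F) (pd 1 φ) - pair (comp 1 F) (pd 0 φ)

section

variable {Ω : Set R3} {F G F' G' : R3 → C3} {φ : R3 → ℂ}

lemma LocInt.add (hF : LocInt Ω F) (hG : LocInt Ω G) : LocInt Ω fun x => F x + G x :=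
  fun k => (hF k).add (hG k)

lemma LocInt.sub (hF : LocInt Ω F) (hG : LocInt Ω G) : LocInt Ω fun x => F x - G x :=
  fun k => (hF k).sub (hG k)

lemma LocInt.smul (c : ℂ) (hF : LocInt Ω F) : LocInt Ω fun x => c • F x :=
  fun k => (hF k).smul c

lemma pair_comp_add (hφ : IsTest Ω φ) (hF : LocInt Ω F) (hG : LocInt Ω G) (k : Fin 3) :
    pair (comp k fun x => F x + G x) φ = pair (comp k F) φ + pair (comp k G) φ :=
  pair_add_left hφ (hF k) (hG k)

lemma pair_comp_sub (hφ : IsTest Ω φ) (hF : LocInt Ω F) (hG : LocInt Ω G) (k : Fin 3) :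
    pair (comp k fun x => F x - G x) φ = pair (comp k F) φ - pair (comp k G) φ :=
  pair_sub_left hφ (hF k) (hG k)

lemma pair_comp_smul (c : ℂ) (k : Fin 3) :
    pair (comp k fun x => c • F x) φ = c * pair (comp k F) φ :=
  pair_const_mul_left c

lemma comp_ae_eq {μ : Measure R3} (h : F =ᵐ[μ] G) (k : Fin 3) : comp k F =ᵐ[μ] comp k G :=
  h.mono fun _ hx => congrFun hx k

namespace IsCurl

lemma add (h : IsCurl Ω F G) (h' : IsCurl Ω F' G') (hF : LocInt Ω F) (hG : LocInt Ω G)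
    (hF' : LocInt Ω F') (hG' : LocInt Ω G') :
    IsCurl Ω (fun x => F x + F' x) (fun x => G x + G' x) := by
  refine ⟨fun φ hφ => ?_, fun φ hφ => ?_, fun φ hφ => ?_⟩
  · rw [pair_comp_add hφ hG hG', pair_comp_add (hφ.pd _) hF hF', pair_comp_add (hφ.pd _) hF hF',
      h.c0 φ hφ, h'.c0 φ hφ]
    ring
  · rw [pair_comp_add hφ hG hG', pair_comp_add (hφ.pd _) hF hF', pair_comp_add (hφ.pd _) hF hF',
      h.c1 φ hφ, h'.c1 φ hφ]
    ring
  · rw [pair_comp_add hφ hG hG', pair_comp_add (hφ.pd _) hF hF', pair_comp_add (hφ.pd _) hF hF',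
      h.c2 φ hφ, h'.c2 φ hφ]
    ring

lemma smul (c : ℂ) (h : IsCurl Ω F G) : IsCurl Ω (fun x => c • F x) (fun x => c • G x) := by
  refine ⟨fun φ hφ => ?_, fun φ hφ => ?_, fun φ hφ => ?_⟩
  · simp only [pair_comp_smul, h.c0 φ hφ]; ring
  · simp only [pair_comp_smul, h.c1 φ hφ]; ring
  · simp only [pair_comp_smul, h.c2 φ hφ]; ring

lemma congr_ae (h : IsCurl Ω F G) (hF : F =ᵐ[volume.restrict Ω] F')
    (hG : G =ᵐ[volume.restrict Ω] G') : IsCurl Ω F' G' := by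
  have e1 := fun (k : Fin 3) {φ} (hφ : IsTest Ω φ) => pair_congr hφ (comp_ae_eq hF k)
  have e2 := fun (k : Fin 3) {φ} (hφ : IsTest Ω φ) => pair_congr hφ (comp_ae_eq hG k)
  refine ⟨fun φ hφ => ?_, fun φ hφ => ?_, fun φ hφ => ?_⟩
  · rw [← e1 _ (hφ.pd _), ← e1 _ (hφ.pd _), ← e2 _ hφ, h.c0 φ hφ]
  · rw [← e1 _ (hφ.pd _), ← e1 _ (hφ.pd _), ← e2 _ hφ, h.c1 φ hφ]
  · rw [← e1 _ (hφ.pd _), ← e1 _ (hφ.pd _), ← e2 _ hφ, h.c2 φ hφ]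

/-- The divergence of a curl vanishes. -/
lemma div_eq_zero (h : IsCurl Ω F G) (hφ : IsTest Ω φ) :
    ∑ i, pair (comp i G) (MaxwellWeak.pd i φ) = 0 := by
  rw [Fin.sum_univ_three, h.c0 _ (hφ.pd 0), h.c1 _ (hφ.pd 1), h.c2 _ (hφ.pd 2),
    pd_comm 1 0 hφ.smooth, pd_comm 2 0 hφ.smooth, pd_comm 2 1 hφ.smooth]
  ring

/-- For divergence-free fields, `curl curl = -Δ`. -/
lemma pair_helm_eq_zero {κ lam : ℂ} (hκ : κ ^ 2 = lam ^ 2) (hκ0 : κ ≠ 0) (hF : LocInt Ω F)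
    (h : IsCurl Ω F fun x => (-κ) • F x) (hφ : IsTest Ω φ) (k : Fin 3) :
    pair (comp k F) (MaxwellWeak.helm lam φ) = 0 := by
  -- F is a nonzero multiple of a curl, hence weakly divergence-free.
  have hdiv : ∀ ψ, IsTest Ω ψ → pair (comp 0 F) (MaxwellWeak.pd 0 ψ) +
      pair (comp 1 F) (MaxwellWeak.pd 1 ψ) + pair (comp 2 F) (MaxwellWeak.pd 2 ψ) = 0 := by
    intro ψ hψ
    have h1 := h.div_eq_zero hψ
    simp only [Fin.sum_univ_three, pair_comp_smul] at h1
    have h2 : (-κ) * (pair (comp 0 F) (MaxwellWeak.pd 0 ψ) +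
      pair (comp 1 F) (MaxwellWeak.pd 1 ψ) + pair (comp 2 F) (MaxwellWeak.pd 2 ψ)) = 0 := by
      linear_combination h1
    exact (mul_eq_zero.1 h2).resolve_left (neg_ne_zero.2 hκ0)
  have c0 := fun ψ hψ => (pair_comp_smul (F := F) (φ := ψ) (-κ) 0).symm.trans (h.c0 ψ hψ)
  have c1 := fun ψ hψ => (pair_comp_smul (F := F) (φ := ψ) (-κ) 1).symm.trans (h.c1 ψ hψ)
  have c2 := fun ψ hψ => (pair_comp_smul (F := F) (φ := ψ) (-κ) 2).symm.trans (h.c2 ψ hψ)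
  rw [MaxwellWeak.pair_helm hφ (hF k), ← hκ]
  have s10 := pd_comm 1 0 hφ.smooth
  have s20 := pd_comm 2 0 hφ.smooth
  have s21 := pd_comm 2 1 hφ.smooth
  fin_cases k
  · have e1 := c1 _ (hφ.pd 2)
    have e2 := c2 _ (hφ.pd 1)
    have e3 := hdiv _ (hφ.pd 0)
    rw [s10, s20] at e3
    have e0 := c0 φ hφ
    simp only [Fin.zero_eta]
    linear_combination e3 - e2 + e1 - κ * e0
  · have e1 := c0 _ (hφ.pd 2)
    have e2 := c2 _ (hφ.pd 0)
    have e3 := hdiv _ (hφ.pd 1)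
    rw [s21, ← s10] at e3
    have e0 := c1 φ hφ
    simp only [Fin.mk_one]
    linear_combination e3 + e2 - e1 - κ * e0
  · have e1 := c0 _ (hφ.pd 1)
    have e2 := c1 _ (hφ.pd 0)
    have e3 := hdiv _ (hφ.pd 2)
    rw [← s20, ← s21] at e3
    have e0 := c2 φ hφ
    simp only [Fin.reduceFinMk]
    linear_combination e3 + e1 - e2 - κ * e0

end IsCurl

/-! ### Vector-valued weak identities in scalar components -/

lemma integral_smul_apply {t : R3 → ℂ} (h : ∀ k, Integrable (fun x => t x * G x k)
    (volume.restrict Ω)) (k : Fin 3) : (∫ x in Ω, t x • G x) k = ∫ x in Ω, t x * G x k := by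
  rw [eval_integral (fun k => by simpa using h k)]
  rfl

lemma integral_cross_apply {t : R3 → C3} (h : ∀ i k, Integrable (fun x => t x i * F x k)
    (volume.restrict Ω)) : ∫ x in Ω, crossProduct (t x) (F x) =
      ![(∫ x in Ω, t x 1 * F x 2) - ∫ x in Ω, t x 2 * F x 1,
        (∫ x in Ω, t x 2 * F x 0) - ∫ x in Ω, t x 0 * F x 2,
        (∫ x in Ω, t x 0 * F x 1) - ∫ x in Ω, t x 1 * F x 0] := by
  have hi : ∀ k, Integrable (fun x => crossProduct (t x) (F x) k) (volume.restrict Ω) := by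
    intro k
    simp only [cross_apply]
    fin_cases k
    · exact (h 1 2).sub (h 2 1)
    · exact (h 2 0).sub (h 0 2)
    · exact (h 0 1).sub (h 1 0)
  funext k
  rw [eval_integral hi]
  simp only [cross_apply]
  fin_cases k
  · exact integral_sub (h 1 2) (h 2 1)
  · exact integral_sub (h 2 0) (h 0 2)
  · exact integral_sub (h 0 1) (h 1 0)

lemma integral_dot_apply {t : R3 → C3} (h : ∀ i k, Integrable (fun x => t x i * F x k)
    (volume.restrict Ω)) : ∫ x in Ω, t x ⬝ᵥ F x = ∑ i, ∫ x in Ω, t x i * F x i := by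
  simp only [dotProduct]
  exact integral_finsetSum _ fun i _ => h i i

lemma mem_smoothTests_iff {t : (R3 → ℂ) × (R3 → C3)} :
    t ∈ smoothTests Ω ↔ IsTest Ω t.1 ∧ t.2 = grad t.1 :=
  ⟨fun ⟨h1, h2, h3, h4⟩ => ⟨⟨h1, h2, h3⟩, h4⟩, fun ⟨⟨h1, h2, h3⟩, h4⟩ => ⟨h1, h2, h3, h4⟩⟩

lemma integral_grad_mul (hφ : IsTest Ω φ) (i k : Fin 3) :
    ∫ x in Ω, grad φ x i * F x k = pair (comp k F) (pd i φ) :=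
  (hφ.pd i).setIntegral_eq (comp k F)

lemma forall_fin_three {P : Fin 3 → Prop} : (∀ i, P i) ↔ P 0 ∧ P 1 ∧ P 2 :=
  ⟨fun h => ⟨h 0, h 1, h 2⟩, fun h i => by fin_cases i; exacts [h.1, h.2.1, h.2.2]⟩

/-- Local integrability lets vector-valued integrals be evaluated componentwise; without it they
could take the default value 0. -/
lemma weakCurl_iff (hF : LocInt Ω F) (hG : LocInt Ω G) :
    WeakCurl (smoothTests Ω) Ω F G ↔ IsCurl Ω F G := by
  have key : ∀ φ, IsTest Ω φ → ((∫ x in Ω, φ x • G x = -∫ x in Ω, crossProduct (grad φ x) (F x)) ↔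
      (pair (comp 0 G) φ = pair (comp 1 F) (pd 2 φ) - pair (comp 2 F) (pd 1 φ) ∧
       pair (comp 1 G) φ = pair (comp 2 F) (pd 0 φ) - pair (comp 0 F) (pd 2 φ) ∧
       pair (comp 2 G) φ = pair (comp 0 F) (pd 1 φ) - pair (comp 1 F) (pd 0 φ))) := by
    intro φ hφ
    rw [integral_cross_apply (t := grad φ) (F := F) fun i k => ((hφ.pd i).integrable_mul (hF k)).restrict]
    simp only [integral_grad_mul hφ]
    rw [funext_iff, forall_fin_three]
    have e : ∀ k, (∫ x in Ω, φ x • G x) k = pair (comp k G) φ := fun k => by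
      rw [integral_smul_apply (t := φ) (G := G) fun k => (hφ.integrable_mul (hG k)).restrict]
      exact hφ.setIntegral_eq (comp k G)
    simp [e]
  constructor
  · intro h
    have h' := fun φ (hφ : IsTest Ω φ) =>
      (key φ hφ).1 (h (φ, grad φ) (mem_smoothTests_iff.2 ⟨hφ, rfl⟩))
    exact ⟨fun φ hφ => (h' φ hφ).1, fun φ hφ => (h' φ hφ).2.1, fun φ hφ => (h' φ hφ).2.2⟩
  · rintro h ⟨φ, g⟩ ht
    obtain ⟨hφ, hg⟩ := mem_smoothTests_iff.1 ht
    simp only at hφ hg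
    subst hg
    exact (key φ hφ).2 ⟨h.c0 φ hφ, h.c1 φ hφ, h.c2 φ hφ⟩

lemma weakDiv_iff (hF : LocInt Ω F) {d : R3 → ℂ} :
    WeakDiv (smoothTests Ω) Ω F d ↔
      ∀ φ, IsTest Ω φ → pair d φ = -∑ i, pair (comp i F) (pd i φ) := by
  have key : ∀ φ, IsTest Ω φ → ((∫ x in Ω, φ x * d x = -∫ x in Ω, grad φ x ⬝ᵥ F x) ↔
      pair d φ = -∑ i, pair (comp i F) (pd i φ)) := by
    intro φ hφ
    rw [integral_dot_apply (t := grad φ) (F := F) fun i k => ((hφ.pd i).integrable_mul (hF k)).restrict]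
    simp only [integral_grad_mul hφ, hφ.setIntegral_eq]
  constructor
  · intro h φ hφ
    exact (key φ hφ).1 (h (φ, grad φ) (mem_smoothTests_iff.2 ⟨hφ, rfl⟩))
  · rintro h ⟨φ, g⟩ ht
    obtain ⟨hφ, hg⟩ := mem_smoothTests_iff.1 ht
    simp only at hφ hg
    subst hg
    exact (key φ hφ).2 (h φ hφ)

/-! ### Fields that are locally in L^p -/

lemma MemLpLoc.locInt {p : ℝ≥0∞} (hp : 1 ≤ p) (hΩ : IsOpen Ω) (hF : MemLpLoc F p Ω) :
    LocInt Ω F := by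
  intro k
  rw [locallyIntegrableOn_iff hΩ.isLocallyClosed]
  intro K hK hKc
  have : IsFiniteMeasure (volume.restrict K) := ⟨by simpa using hKc.measure_lt_top⟩
  exact ((hF K hK hKc).eval k).integrable hp

lemma MemLpLoc.congr_ae {p : ℝ≥0∞} (hF : MemLpLoc F p Ω) (h : F =ᵐ[volume.restrict Ω] G) :
    MemLpLoc G p Ω := fun K hK hKc =>
  (hF K hK hKc).ae_eq (ae_restrict_of_ae_restrict_of_subset hK h)

lemma MemLpLoc.add {p : ℝ≥0∞} (hF : MemLpLoc F p Ω) (hG : MemLpLoc G p Ω) :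
    MemLpLoc (fun x => F x + G x) p Ω := fun K hK hKc => (hF K hK hKc).add (hG K hK hKc)

lemma MemLpLoc.sub {p : ℝ≥0∞} (hF : MemLpLoc F p Ω) (hG : MemLpLoc G p Ω) :
    MemLpLoc (fun x => F x - G x) p Ω := fun K hK hKc => (hF K hK hKc).sub (hG K hK hKc)

lemma MemLpLoc.smul {p : ℝ≥0∞} (c : ℂ) (hF : MemLpLoc F p Ω) :
    MemLpLoc (fun x => c • F x) p Ω := fun K hK hKc => (hF K hK hKc).const_smul c

lemma memLpLoc_of_memLp {p : ℝ≥0∞} (hF : MemLp F p (volume.restrict Ω)) : MemLpLoc F p Ω :=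
  fun _ hK _ => hF.mono_measure (Measure.restrict_mono_set _ hK)

lemma memLpLoc_of_continuousOn {p : ℝ≥0∞} (hF : ContinuousOn F Ω) : MemLpLoc F p Ω := by
  intro K hK hKc
  have : IsFiniteMeasure (volume.restrict K) := ⟨by simpa using hKc.measure_lt_top⟩
  obtain ⟨C, hC⟩ := hKc.exists_bound_of_continuousOn (hF.mono hK)
  exact MemLp.of_bound ((hF.mono hK).aestronglyMeasurable_of_isCompact hKc hKc.measurableSet) C
    (ae_restrict_of_forall_mem hKc.measurableSet hC)

end

/-! ### Force-free fields as distributional solutions -/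

section ForceFree

variable {Ω : Set R3} {u : R3 → C3} {κ lam : ℂ}

lemma pd_comp_eq {x : R3} (hu : DifferentiableAt ℝ u x) (i k : Fin 3) :
    pd i (comp k u) x = partialDeriv u i k x := by
  have h : fderiv ℝ (comp k u) x = (ContinuousLinearMap.proj k).comp (fderiv ℝ u x) :=
    ((ContinuousLinearMap.proj (R := ℝ) (φ := fun _ : Fin 3 => ℂ) k).hasFDerivAt.comp x
      hu.hasFDerivAt).fderiv
  rw [pd, h]
  rfl

lemma contDiffOn_comp (hu : ContDiffOn ℝ 1 u Ω) (k : Fin 3) : ContDiffOn ℝ 1 (comp k u) Ω :=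
  contDiffOn_pi.1 hu k

lemma continuousOn_pd_comp (hΩ : IsOpen Ω) (hu : ContDiffOn ℝ 1 u Ω) (i k : Fin 3) :
    ContinuousOn (pd i (comp k u)) Ω :=
  ((contDiffOn_comp hu k).continuousOn_fderiv_of_isOpen hΩ le_rfl).clm_apply continuousOn_const

lemma differentiableAt_of_contDiffOn (hΩ : IsOpen Ω) (hu : ContDiffOn ℝ 1 u Ω) {x : R3}
    (hx : x ∈ Ω) : DifferentiableAt ℝ u x :=
  (hu.differentiableOn one_ne_zero).differentiableAt (hΩ.mem_nhds hx)

/-- The classical curl is the distributional curl. -/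
lemma isCurl_curl (hΩ : IsOpen Ω) (hu : ContDiffOn ℝ 1 u Ω) : IsCurl Ω u (curl u) := by
  have hl : ∀ i k, LocallyIntegrableOn (pd i (comp k u)) Ω := fun i k =>
    (continuousOn_pd_comp hΩ hu i k).locallyIntegrableOn hΩ.measurableSet
  have e : ∀ (φ : R3 → ℂ) (_ : IsTest Ω φ) (c i k i' k' : Fin 3),
      (∀ x, curl u x c = partialDeriv u i k x - partialDeriv u i' k' x) →
      pair (comp c (curl u)) φ = pair (comp k' u) (pd i' φ) - pair (comp k u) (pd i φ) := by
    intro φ hφ c i k i' k' h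
    have h1 : comp c (curl u) =ᵐ[volume.restrict Ω]
        fun x => pd i (comp k u) x - pd i' (comp k' u) x := by
      refine ae_restrict_of_forall_mem hΩ.measurableSet fun x hx => ?_
      have hd := differentiableAt_of_contDiffOn hΩ hu hx
      simp only [pd_comp_eq hd]
      exact h x
    rw [pair_congr hφ h1, pair_sub_left hφ (hl i k) (hl i' k'),
      pair_pd hΩ hφ (contDiffOn_comp hu k), pair_pd hΩ hφ (contDiffOn_comp hu k')]
    ring
  exact ⟨fun φ hφ => e φ hφ 0 1 2 2 1 fun x => rfl, fun φ hφ => e φ hφ 1 2 0 0 2 fun x => rfl,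
    fun φ hφ => e φ hφ 2 0 1 1 0 fun x => rfl⟩

lemma IsForceFree.isCurl (hΩ : IsOpen Ω) (h : IsForceFree Ω κ u) :
    IsCurl Ω u fun x => (-κ) • u x := by
  refine (isCurl_curl hΩ h.contDiffOn).congr_ae (ae_eq_refl _) ?_
  refine ae_restrict_of_forall_mem hΩ.measurableSet fun x hx => ?_
  simp only [neg_smul]
  exact eq_neg_of_add_eq_zero_left (h.curl_eq x hx)

lemma continuousOn_curl (hΩ : IsOpen Ω) (hu : ContDiffOn ℝ 1 u Ω) : ContinuousOn (curl u) Ω := by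
  have hc : ∀ i k, ContinuousOn (partialDeriv u i k) Ω := fun i k =>
    (continuousOn_pd_comp hΩ hu i k).congr fun x hx =>
      (pd_comp_eq (differentiableAt_of_contDiffOn hΩ hu hx) i k).symm
  refine continuousOn_pi.2 fun k => ?_
  fin_cases k
  · exact (hc 1 2).sub (hc 2 1)
  · exact (hc 2 0).sub (hc 0 2)
  · exact (hc 0 1).sub (hc 1 0)

lemma eqOn_of_pair_comp_eq {F G : R3 → C3} (hΩ : IsOpen Ω) (hF : ContinuousOn F Ω)
    (hG : ContinuousOn G Ω)
    (h : ∀ k φ, IsTest Ω φ → pair (comp k F) φ = pair (comp k G) φ) : Set.EqOn F G Ω := by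
  intro x hx
  funext k
  have hF' : ContinuousOn (comp k F) Ω := continuousOn_pi.1 hF k
  have hG' : ContinuousOn (comp k G) Ω := continuousOn_pi.1 hG k
  exact Measure.eqOn_open_of_ae_eq (ae_eq_of_pair_eq hΩ
    (hF'.locallyIntegrableOn hΩ.measurableSet) (hG'.locallyIntegrableOn hΩ.measurableSet) (h k))
    hΩ hF' hG' hx

/-- A locally integrable distributional solution of `curl w + κ w = 0` is almost everywhere equal
to a force-free field. -/
theorem exists_isForceFree (hΩ : IsOpen Ω) (hlam : 0 ≤ lam.im) (hκ : κ ^ 2 = lam ^ 2)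
    (hκ0 : κ ≠ 0) {w : R3 → C3} (hw : LocInt Ω w) (h : IsCurl Ω w fun x => (-κ) • w x) :
    ∃ u, IsForceFree Ω κ u ∧ w =ᵐ[volume.restrict Ω] u := by
  -- Weyl's lemma is applied to each component; `κ ^ 2 = lam ^ 2` allows the same fundamental
  -- solution for both signs of κ.
  choose v hv hwv using fun k => exists_smooth_rep hlam hΩ (hw k)
    fun φ hφ => h.pair_helm_eq_zero hκ hκ0 hw hφ k
  set u : R3 → C3 := fun x k => v k x with hu
  have hu1 : ContDiffOn ℝ 1 u Ω := contDiffOn_pi.2 fun k => (hv k).of_le (by simp)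
  have hwu : w =ᵐ[volume.restrict Ω] u := by
    filter_upwards [eventually_all.2 hwv] with x hx
    funext k
    exact hx k
  have hcu : IsCurl Ω u fun x => (-κ) • u x :=
    h.congr_ae hwu (hwu.mono fun x hx => by simp only [hx])
  -- Both sides are continuous and agree as distributions, so they agree pointwise.
  have hcurl : Set.EqOn (curl u) (fun x => (-κ) • u x) Ω := by
    have hcc := isCurl_curl hΩ hu1
    have hsm : ContinuousOn (fun x => (-κ) • u x) Ω := hu1.continuousOn.const_smul (-κ)
    refine eqOn_of_pair_comp_eq hΩ (continuousOn_curl hΩ hu1) hsm fun k φ hφ => ?_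
    fin_cases k
    · exact (hcc.c0 φ hφ).trans (hcu.c0 φ hφ).symm
    · exact (hcc.c1 φ hφ).trans (hcu.c1 φ hφ).symm
    · exact (hcc.c2 φ hφ).trans (hcu.c2 φ hφ).symm
  refine ⟨u, ⟨hu1, ?_, fun x hx => ?_⟩, hwu⟩
  · have hc : ∀ i, ContinuousOn (pd i (comp i u)) Ω := fun i => continuousOn_pd_comp hΩ hu1 i i
    have hl := fun i => (hc i).locallyIntegrableOn hΩ.measurableSet (μ := volume)
    have hsum : ContinuousOn (fun x => ∑ i, pd i (comp i u) x) Ω :=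
      continuousOn_finsetSum _ fun i _ => hc i
    have hae := ae_eq_of_pair_eq hΩ (hsum.locallyIntegrableOn hΩ.measurableSet)
      (g := fun _ => 0) (continuousOn_const.locallyIntegrableOn hΩ.measurableSet)
      fun φ hφ => by
        rw [pair_sum_left hφ hl]
        simp only [pair_pd hΩ hφ (contDiffOn_comp hu1 _), Finset.sum_neg_distrib]
        have h1 := hcu.div_eq_zero hφ
        simp only [pair_comp_smul, ← Finset.mul_sum] at h1
        rw [(mul_eq_zero.1 h1).resolve_left (neg_ne_zero.2 hκ0)]
        simp [pair]
    intro x hx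
    have := Measure.eqOn_open_of_ae_eq hae hΩ hsum continuousOn_const hx
    have hd := differentiableAt_of_contDiffOn hΩ hu1 hx
    simpa only [divergence, ← pd_comp_eq hd] using this
  · simp only [hcurl hx, neg_smul, neg_add_cancel]

end ForceFree

/-! ### The volume potential and the Teodorescu operators -/

section Potential

variable {Ω : Set R3} {A B C j : R3 → C3} {lam κ : ℂ}

/-- Here C = curl A, and B stands for grad div A. The identity is curl curl A = grad div A - ΔA,
with ΔA = j - λ²A. -/
lemma isCurl_teodorescu (hA : LocInt Ω A) (hB : LocInt Ω B)
    (hC : LocInt Ω C) (hj : LocInt Ω j) (hcurl : IsCurl Ω A C)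
    (hgrad : ∀ i φ, IsTest Ω φ →
      pair (comp i B) φ = ∑ l, pair (comp l A) (pd l (pd i φ)))
    (hhelm : ∀ k φ, IsTest Ω φ → pair (comp k A) (helm lam φ) = pair (comp k j) φ) :
    IsCurl Ω (fun x => κ • A x - C x) (fun x => κ • C x - B x + (j x - lam ^ 2 • A x)) := by
  have eG : ∀ k φ, IsTest Ω φ →
      pair (comp k fun x => κ • C x - B x + (j x - lam ^ 2 • A x)) φ =
      κ * pair (comp k C) φ - pair (comp k B) φ + (pair (comp k j) φ - lam ^ 2 * pair (comp k A) φ)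
      := fun k φ hφ => by
    rw [pair_comp_add hφ ((hC.smul κ).sub hB) (hj.sub (hA.smul _)),
      pair_comp_sub hφ (hC.smul κ) hB, pair_comp_sub hφ hj (hA.smul _), pair_comp_smul,
      pair_comp_smul]
  have eF : ∀ k φ, IsTest Ω φ → pair (comp k fun x => κ • A x - C x) φ =
      κ * pair (comp k A) φ - pair (comp k C) φ := fun k φ hφ => by
    rw [pair_comp_sub hφ (hA.smul κ) hC, pair_comp_smul]
  refine ⟨fun φ hφ => ?_, fun φ hφ => ?_, fun φ hφ => ?_⟩
  · rw [eG _ _ hφ, eF _ _ (hφ.pd _), eF _ _ (hφ.pd _), ← hhelm _ _ hφ, pair_helm hφ (hA _),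
      hgrad _ _ hφ, hcurl.c1 _ (hφ.pd _), hcurl.c2 _ (hφ.pd _), hcurl.c0 _ hφ, Fin.sum_univ_three,
      pd_comm 1 0 hφ.smooth, pd_comm 2 0 hφ.smooth]
    ring
  · rw [eG _ _ hφ, eF _ _ (hφ.pd _), eF _ _ (hφ.pd _), ← hhelm _ _ hφ, pair_helm hφ (hA _),
      hgrad _ _ hφ, hcurl.c2 _ (hφ.pd _), hcurl.c0 _ (hφ.pd _), hcurl.c1 _ hφ, Fin.sum_univ_three,
      pd_comm 1 0 hφ.smooth, pd_comm 2 1 hφ.smooth]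
    ring
  · rw [eG _ _ hφ, eF _ _ (hφ.pd _), eF _ _ (hφ.pd _), ← hhelm _ _ hφ, pair_helm hφ (hA _),
      hgrad _ _ hφ, hcurl.c1 _ (hφ.pd _), hcurl.c0 _ (hφ.pd _), hcurl.c2 _ hφ, Fin.sum_univ_three,
      pd_comm 2 0 hφ.smooth, pd_comm 2 1 hφ.smooth]
    ring

/-- Write S for the curl in `hT`. Since κ² = λ², the terms regroup as j - S = κ(κA - C) + B, where B
is a gradient and so has zero curl. -/
lemma isCurl_source_sub (hκ : κ ^ 2 = lam ^ 2) (hA : LocInt Ω A) (hB : LocInt Ω B)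
    (hC : LocInt Ω C) (hj : LocInt Ω j)
    (hgrad : ∀ i φ, IsTest Ω φ →
      pair (comp i B) φ = ∑ l, pair (comp l A) (pd l (pd i φ)))
    (hT : IsCurl Ω (fun x => κ • A x - C x)
      (fun x => κ • C x - B x + (j x - lam ^ 2 • A x))) :
    IsCurl Ω (fun x => j x - (κ • C x - B x + (j x - lam ^ 2 • A x)))
      (fun x => κ • (κ • C x - B x + (j x - lam ^ 2 • A x))) := by
  have hBcurl : IsCurl Ω B fun _ => 0 := by
    have h0 : ∀ (k : Fin 3) (φ : R3 → ℂ), pair (comp k fun _ => 0) φ = 0 := fun k φ => by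
      simp [pair, comp]
    refine ⟨fun φ hφ => ?_, fun φ hφ => ?_, fun φ hφ => ?_⟩ <;>
    rw [h0, hgrad _ _ (hφ.pd _), hgrad _ _ (hφ.pd _)]
    · rw [pd_comm 1 2 hφ.smooth, sub_self]
    · rw [pd_comm 2 0 hφ.smooth, sub_self]
    · rw [pd_comm 0 1 hφ.smooth, sub_self]
  have h0 : LocInt Ω fun _ => 0 := fun k =>
    (integrable_zero _ _ _).locallyIntegrable.locallyIntegrableOn _
  have hG := ((hC.smul κ).sub hB).add (hj.sub (hA.smul (lam ^ 2)))
  have h1 := (hT.smul κ).add hBcurl (((hA.smul κ).sub hC).smul κ) (hG.smul κ) hB h0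
  have e1 : (fun x => κ • (κ • A x - C x) + B x) =
      fun x => j x - (κ • C x - B x + (j x - lam ^ 2 • A x)) := by
    funext x
    rw [← hκ]
    module
  have e2 : (fun x => κ • (κ • C x - B x + (j x - lam ^ 2 • A x)) + 0) =
      fun x => κ • (κ • C x - B x + (j x - lam ^ 2 • A x)) := by
    funext x
    rw [add_zero]
  rwa [e1, e2] at h1

end Potential

/-! ### The Teodorescu operators through a parametrix -/

section Teodorescu

variable {Ω : Set R3} {lam κ : ℂ} {R : ℝ} {N k : R3 → ℂ} {DN : Fin 3 → R3 → ℂ} {J : R3 → C3}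

/-- The volume potential `θ * J`, computed with a parametrix. -/
def volumePotential (N : R3 → ℂ) (J : R3 → C3) (x : R3) : C3 := fun k => conv N (comp k J) x

/-- The curl of the volume potential. -/
def curlPotential (DN : Fin 3 → R3 → ℂ) (J : R3 → C3) (x : R3) : C3 :=
  ![conv (DN 1) (comp 2 J) x - conv (DN 2) (comp 1 J) x,
    conv (DN 2) (comp 0 J) x - conv (DN 0) (comp 2 J) x,
    conv (DN 0) (comp 1 J) x - conv (DN 1) (comp 0 J) x]

lemma memLp_volumePotential {p : ℝ≥0∞} (hp : 1 < p) (hp_top : p < ⊤)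
    (hN : IsParametrix lam R N DN k) (hJ : ∀ k, Integrable (comp k J))
    (hJp : ∀ k, MemLp (comp k J) p) : MemLp (volumePotential N J) p :=
  MemLp.of_eval fun k => memLp_conv hp hp_top hN.integrable (hJ k) (hJp k)

lemma memLp_curlPotential {p : ℝ≥0∞} (hp : 1 < p) (hp_top : p < ⊤)
    (hN : IsParametrix lam R N DN k) (hJ : ∀ k, Integrable (comp k J))
    (hJp : ∀ k, MemLp (comp k J) p) : MemLp (curlPotential DN J) p := by
  have h := fun i k => memLp_conv hp hp_top (hN.integrable_grad i) (hJ k) (hJp k)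
  refine MemLp.of_eval fun k => ?_
  fin_cases k
  · exact (h 1 2).sub (h 2 1)
  · exact (h 2 0).sub (h 0 2)
  · exact (h 0 1).sub (h 1 0)

lemma isCurl_curlPotential (hN : IsParametrix lam R N DN k) (hJ : ∀ k, Integrable (comp k J)) :
    IsCurl Ω (volumePotential N J) (curlPotential DN J) := by
  have hl : ∀ i l, LocallyIntegrableOn (conv (DN i) (comp l J)) Ω := fun i l =>
    (integrable_conv (hN.integrable_grad i) (hJ l)).locallyIntegrable.locallyIntegrableOn _
  have e : ∀ φ, IsTest Ω φ → ∀ i l i' l',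
      pair (fun x => conv (DN i) (comp l J) x - conv (DN i') (comp l' J) x) φ =
      pair (conv N (comp l' J)) (pd i' φ) - pair (conv N (comp l J)) (pd i φ) := by
    intro φ hφ i l i' l'
    rw [pair_sub_left hφ (hl _ _) (hl _ _), hN.pair_conv_pd hφ (hJ _), hN.pair_conv_pd hφ (hJ _)]
    ring
  exact ⟨fun φ hφ => e φ hφ 1 2 2 1, fun φ hφ => e φ hφ 2 0 0 2, fun φ hφ => e φ hφ 0 1 1 0⟩

/-- Points of `Ω` are less than R apart, where the error kernel vanishes; so the parametrix inverts
Δ + λ² exactly inside `Ω`. -/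
lemma pair_volumePotential_helm (hN : IsParametrix lam R N DN k)
    (hJ : ∀ k, Integrable (comp k J)) (hJ0 : ∀ x ∉ Ω, J x = 0)
    (hR : ∀ x ∈ Ω, ∀ y ∈ Ω, ‖x - y‖ < R) (i : Fin 3) {φ : R3 → ℂ} (hφ : IsTest Ω φ) :
    pair (comp i (volumePotential N J)) (helm lam φ) = pair (comp i J) φ := by
  have h1 := pair_conv_of_even (hφ.helm lam) hN.integrable (hJ i) hN.even
  rw [hN.conv_helm hφ] at h1
  refine h1.trans ?_
  refine integral_congr_ae (Eventually.of_forall fun y => ?_)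
  by_cases hy : y ∈ Ω
  · have : conv k φ y = 0 := by
      refine integral_eq_zero_of_ae (Eventually.of_forall fun x => ?_)
      by_cases hx : x ∈ Ω
      · simp [hN.err_eq_zero _ (hR y hy x hx)]
      · simp [hφ.eq_zero hx]
    simp [this]
  · simp [comp, hJ0 y hy]

lemma teodorescuIntegrand_eq (hN : IsParametrix lam R N DN k) {x y : R3} (hxy : ‖x - y‖ < R) :
    teodorescuIntegrand lam κ J x y =
      ![κ * (N (x - y) * J y 0) - (DN 1 (x - y) * J y 2 - DN 2 (x - y) * J y 1),
        κ * (N (x - y) * J y 1) - (DN 2 (x - y) * J y 0 - DN 0 (x - y) * J y 2),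
        κ * (N (x - y) * J y 2) - (DN 0 (x - y) * J y 1 - DN 1 (x - y) * J y 0)] := by
  funext i
  simp only [teodorescuIntegrand, cross_apply, hN.eq_theta _ hxy, hN.grad_eq _ _ hxy]
  fin_cases i <;> simp <;> ring

/-- Within `Ω` the true kernels coincide with the truncated ones. Those are integrable on the whole
space, so Fubini gives absolute convergence for a.e. x. -/
lemma teodorescu_ae (hΩ : MeasurableSet Ω) (hN : IsParametrix lam R N DN k)
    (hJ : ∀ k, Integrable (comp k J)) (hJ0 : ∀ x ∉ Ω, J x = 0)
    (hR : ∀ x ∈ Ω, ∀ y ∈ Ω, ‖x - y‖ < R) (κ : ℂ) :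
    ∀ᵐ x ∂(volume.restrict Ω), IntegrableOn (teodorescuIntegrand lam κ J x) Ω ∧
      teodorescuTwo Ω lam κ J x = κ • volumePotential N J x - curlPotential DN J x := by
  have h1 : ∀ᵐ x : R3, ∀ k, Integrable fun y => N (x - y) * comp k J y :=
    ae_all_iff.2 fun k => ae_integrable_conv hN.integrable (hJ k)
  have h2 : ∀ᵐ x : R3, ∀ i k, Integrable fun y => DN i (x - y) * comp k J y :=
    ae_all_iff.2 fun i => ae_all_iff.2 fun k => ae_integrable_conv (hN.integrable_grad i) (hJ k)
  rw [ae_restrict_iff' hΩ]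
  filter_upwards [h1, h2] with x hx1 hx2 hx
  set g : R3 → C3 := fun y =>
    ![κ * (N (x - y) * J y 0) - (DN 1 (x - y) * J y 2 - DN 2 (x - y) * J y 1),
      κ * (N (x - y) * J y 1) - (DN 2 (x - y) * J y 0 - DN 0 (x - y) * J y 2),
      κ * (N (x - y) * J y 2) - (DN 0 (x - y) * J y 1 - DN 1 (x - y) * J y 0)] with hg
  have hgi : ∀ i, Integrable fun y => g y i := by
    intro i
    fin_cases i
    · exact ((hx1 0).const_mul κ).sub ((hx2 1 2).sub (hx2 2 1))
    · exact ((hx1 1).const_mul κ).sub ((hx2 2 0).sub (hx2 0 2))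
    · exact ((hx1 2).const_mul κ).sub ((hx2 0 1).sub (hx2 1 0))
  have heq : Set.EqOn g (teodorescuIntegrand lam κ J x) Ω := fun y hy =>
    (teodorescuIntegrand_eq hN (hR x hx y hy)).symm
  have hg0 : ∀ y, y ∉ Ω → g y = 0 := fun y hy => by
    simp [hg, hJ0 y hy]
  have hint : Integrable g := Integrable.of_eval hgi
  refine ⟨hint.integrableOn.congr_fun heq hΩ, ?_⟩
  rw [teodorescuTwo, ← setIntegral_congr_fun hΩ heq,
    setIntegral_eq_integral_of_forall_compl_eq_zero hg0]
  have e : ∀ (a b c : R3 → ℂ), Integrable a → Integrable b → Integrable c →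
      ∫ y, (κ * a y - (b y - c y)) = κ * (∫ y, a y) - ((∫ y, b y) - ∫ y, c y) := by
    intro a b c ha hb hc
    rw [← integral_sub hb hc, ← integral_const_mul]
    exact integral_sub (ha.const_mul κ) (hb.sub hc)
  funext i
  rw [eval_integral hgi]
  fin_cases i
  · exact e _ _ _ (hx1 0) (hx2 1 2) (hx2 2 1)
  · exact e _ _ _ (hx1 1) (hx2 2 0) (hx2 0 2)
  · exact e _ _ _ (hx1 2) (hx2 0 1) (hx2 1 0)

lemma teodorescu_indicator (hΩ : MeasurableSet Ω) (j : R3 → C3) (lam κ : ℂ) (x : R3) :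
    Set.EqOn (teodorescuIntegrand lam κ (Ω.indicator j) x) (teodorescuIntegrand lam κ j x) Ω ∧
      teodorescuTwo Ω lam κ (Ω.indicator j) x = teodorescuTwo Ω lam κ j x := by
  have h : Set.EqOn (teodorescuIntegrand lam κ (Ω.indicator j) x)
      (teodorescuIntegrand lam κ j x) Ω := fun y hy => by
    simp only [teodorescuIntegrand, Set.indicator_of_mem hy]
  exact ⟨h, setIntegral_congr_fun hΩ h⟩

/-- The Teodorescu operators have weak curls in `L^p_loc`, and `j - curl T_κ[j]` solves the
inhomogeneous force-free equation with right-hand side `κ j`. -/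
theorem exists_curl_teodorescu (hΩ : IsOpen Ω) (hb : Bornology.IsBounded Ω) {p : ℝ≥0∞}
    (hp : 1 < p) (hp_top : p < ⊤) (hlam : 0 ≤ lam.im) {j : R3 → C3} {divj : R3 → ℂ}
    (hj : MemWDiv Ω p j divj) :
    ∃ S : ℂ → R3 → C3, ∀ κ, κ ^ 2 = lam ^ 2 →
      (∀ᵐ x ∂(volume.restrict Ω), IntegrableOn (teodorescuIntegrand lam κ j x) Ω) ∧
      MemLpLoc (teodorescuTwo Ω lam κ j) p Ω ∧ MemLpLoc (S κ) p Ω ∧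
      IsCurl Ω (teodorescuTwo Ω lam κ j) (S κ) ∧
      IsCurl Ω (fun x => j x - S κ x) (fun x => κ • S κ x) := by
  have hΩm := hΩ.measurableSet
  have hfin : IsFiniteMeasure (volume.restrict Ω) := ⟨by simpa using hb.measure_lt_top⟩
  -- The exhaustion by distance to the complement needs a nonempty complement.
  have hne : Ωᶜ.Nonempty := by
    rw [Set.nonempty_compl]
    rintro rfl
    exact NormedSpace.unbounded_univ ℝ R3 hb
  have hR : ∀ x ∈ Ω, ∀ y ∈ Ω, ‖x - y‖ < Metric.diam Ω + 1 := fun x hx y hy => by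
    rw [← dist_eq_norm]
    exact (Metric.dist_le_diam_of_mem hb hx hy).trans_lt (lt_add_one _)
  -- The summand 1 makes the radius positive and strictly larger than every distance within `Ω`.
  have hR0 : 0 < Metric.diam Ω + 1 := by have := Metric.diam_nonneg (s := Ω); linarith
  obtain ⟨N, DN, k, hN⟩ := exists_isParametrix hlam hR0
  obtain ⟨hjp, hdp, hdiv⟩ := hj
  set J := Ω.indicator j with hJdef
  have hcomp : ∀ k, comp k J = Ω.indicator (comp k j) := fun k => by
    funext x
    by_cases hx : x ∈ Ω <;> simp [comp, hJdef, hx]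
  have hJ0 : ∀ x ∉ Ω, J x = 0 := fun x hx => Set.indicator_of_notMem hx _
  have hJ : ∀ k, Integrable (comp k J) := fun k => by
    rw [hcomp, integrable_indicator_iff hΩm]
    exact (hjp.eval k).integrable hp.le
  have hJp : ∀ k, MemLp (comp k J) p := fun k => by
    rw [hcomp, memLp_indicator_iff_restrict hΩm]
    exact hjp.eval k
  have hjJ : J =ᵐ[volume.restrict Ω] j := indicator_ae_eq_restrict hΩm
  have hjl : LocInt Ω j := (memLpLoc_of_memLp hjp).locInt hp.le hΩ
  have hJl : LocInt Ω J := fun k => (hJ k).locallyIntegrable.locallyIntegrableOn _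
  -- Extending j and div j by zero creates no boundary term, because only test functions supported
  -- in `Ω` occur.
  have hJdiv : ∀ φ, IsTest Ω φ →
      pair (Ω.indicator divj) φ = -∑ i, pair (comp i J) (pd i φ) := fun φ hφ => by
    rw [pair_congr hφ (indicator_ae_eq_restrict hΩm), (weakDiv_iff hjl).1 hdiv φ hφ]
    simp only [pair_congr (hφ.pd _) (comp_ae_eq hjJ _)]
  choose B hBp hB using fun i => exists_grad_div hΩ hne hlam hp hp_top hJ hJp
    ((integrable_indicator_iff hΩm).2 (hdp.integrable hp.le))
    ((memLp_indicator_iff_restrict hΩm).2 hdp) hJdiv hR0 hN i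
  set A := volumePotential N J with hAdef
  set C := curlPotential DN J with hCdef
  set B' : R3 → C3 := fun x i => B i x with hB'def
  have hAm : MemLpLoc A p Ω := fun K _ _ => (memLp_volumePotential hp hp_top hN hJ hJp).restrict K
  have hCm : MemLpLoc C p Ω := fun K _ _ => (memLp_curlPotential hp hp_top hN hJ hJp).restrict K
  have hBm : MemLpLoc B' p Ω := fun K hK hKc => MemLp.of_eval fun i => hBp i K hK hKc
  have hJm : MemLpLoc J p Ω := (memLpLoc_of_memLp hjp).congr_ae hjJ.symm
  have hcurl : IsCurl Ω A C := isCurl_curlPotential hN hJ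
  have hAl := hAm.locInt hp.le hΩ
  have hBl := hBm.locInt hp.le hΩ
  have hCl := hCm.locInt hp.le hΩ
  -- This is κ curl A - grad div A + ΔA; A, B' and C do not depend on the sign of κ.
  refine ⟨fun κ x => κ • C x - B' x + (J x - lam ^ 2 • A x), fun κ hκ => ?_⟩
  have hae := teodorescu_ae hΩm hN hJ hJ0 hR κ
  have hT : teodorescuTwo Ω lam κ j =ᵐ[volume.restrict Ω] fun x => κ • A x - C x := by
    filter_upwards [hae] with x hx
    rw [← (teodorescu_indicator hΩm j lam κ x).2]
    exact hx.2
  have hTcurl := isCurl_teodorescu (κ := κ) hAl hBl hCl hJl hcurl hB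
    fun i φ hφ => pair_volumePotential_helm hN hJ hJ0 hR i hφ
  refine ⟨?_, ((hAm.smul κ).sub hCm).congr_ae hT.symm,
    ((hCm.smul κ).sub hBm).add (hJm.sub (hAm.smul _)),
    hTcurl.congr_ae hT.symm (ae_eq_refl _), ?_⟩
  · filter_upwards [hae] with x hx
    exact hx.1.congr_fun (teodorescu_indicator hΩm j lam κ x).1 hΩm
  · refine (isCurl_source_sub hκ hAl hBl hCl hJl hB hTcurl).congr_ae ?_ (ae_eq_refl _)
    filter_upwards [hjJ] with x hx
    rw [hx]

end Teodorescu

/-! ### Test functions in the Sobolev space -/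

section Sobolev

variable {Ω : Set R3} {p q : ℝ≥0∞} {F G : R3 → C3}

/-- Hölder's inequality turns convergence in L^q into L¹ convergence of the products with `g`. -/
lemma tendsto_integral_mul [ENNReal.HolderTriple q p 1] {μ : Measure R3} {f : ℕ → R3 → ℂ}
    {f₀ g : R3 → ℂ} (hf : ∀ n, MemLp (f n) q μ) (hf₀ : MemLp f₀ q μ) (hg : MemLp g p μ)
    (h : Tendsto (fun n => eLpNorm (f n - f₀) q μ) atTop (𝓝 0)) :
    Tendsto (fun n => ∫ x, f n x * g x ∂μ) atTop (𝓝 (∫ x, f₀ x * g x ∂μ)) := by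
  refine tendsto_integral_of_L1' _ (hf₀.integrable_mul hg).aestronglyMeasurable
    (Eventually.of_forall fun n => (hf n).integrable_mul hg) ?_
  have hb : ∀ n, eLpNorm ((fun x => f n x * g x) - fun x => f₀ x * g x) 1 μ
      ≤ eLpNorm (f n - f₀) q μ * eLpNorm g p μ := fun n => by
    have e : ((fun x => f n x * g x) - fun x => f₀ x * g x) = (f n - f₀) • g := by
      funext x
      simp [sub_mul]
    rw [e]
    exact eLpNorm_smul_le_mul_eLpNorm hg.1 ((hf n).sub hf₀).1
  have h0 := ENNReal.Tendsto.mul_const (b := eLpNorm g p μ) h (Or.inr hg.2.ne)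
  rw [zero_mul] at h0
  exact tendsto_of_tendsto_of_tendsto_of_le_of_le tendsto_const_nhds h0 (fun _ => zero_le) hb

lemma memLp_of_smoothTests {μ : Measure R3} [IsFiniteMeasureOnCompacts μ]
    {t : (R3 → ℂ) × (R3 → C3)} (ht : t ∈ smoothTests Ω) : MemLp t.1 q μ ∧ MemLp t.2 q μ := by
  obtain ⟨hφ, hg⟩ := mem_smoothTests_iff.1 ht
  refine ⟨hφ.continuous.memLp_of_hasCompactSupport hφ.compact, ?_⟩
  rw [hg]
  exact MemLp.of_eval fun i =>
    (hφ.pd i).continuous.memLp_of_hasCompactSupport (hφ.pd i).compact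

lemma smoothTests_subset_sobolevTests (Ω : Set R3) (q : ℝ≥0∞) :
    smoothTests Ω ⊆ sobolevTests Ω q := by
  intro t ht
  obtain ⟨h1, h2⟩ := memLp_of_smoothTests (q := q) (μ := volume.restrict Ω) ht
  have hg : t.2 = grad t.1 := (mem_smoothTests_iff.1 ht).2
  refine ⟨h1, h2, fun _ => t.1, fun _ => hg ▸ ht, ?_, ?_⟩
  · simp
  · simp [hg]

lemma eLpNorm_comp_le {μ : Measure R3} (F : R3 → C3) (k : Fin 3) :
    eLpNorm (comp k F) q μ ≤ eLpNorm F q μ :=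
  eLpNorm_mono fun x => norm_le_pi_norm (F x) k

/-- Weak identities against smooth test functions extend to `W₀^{1,q}` by density. -/
lemma tendsto_sobolevTests [ENNReal.HolderTriple q p 1] {t : (R3 → ℂ) × (R3 → C3)}
    (ht : t ∈ sobolevTests Ω q) :
    ∃ φ : ℕ → R3 → ℂ, (∀ n, (φ n, grad (φ n)) ∈ smoothTests Ω) ∧
      (∀ g, MemLp g p (volume.restrict Ω) →
        Tendsto (fun n => ∫ x in Ω, φ n x * g x) atTop (𝓝 (∫ x in Ω, t.1 x * g x))) ∧
      ∀ i g, MemLp g p (volume.restrict Ω) →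
        Tendsto (fun n => ∫ x in Ω, grad (φ n) x i * g x) atTop
          (𝓝 (∫ x in Ω, t.2 x i * g x)) := by
  obtain ⟨h1, h2, φ, hφ, hl1, hl2⟩ := ht
  have hm := fun n => memLp_of_smoothTests (q := q) (μ := volume.restrict Ω) (hφ n)
  refine ⟨φ, hφ, fun g hg => tendsto_integral_mul (fun n => (hm n).1) h1 hg hl1,
    fun i g hg => tendsto_integral_mul (fun n => (hm n).2.eval i) (h2.eval i) hg ?_⟩
  exact tendsto_of_tendsto_of_tendsto_of_le_of_le tendsto_const_nhds hl2 (fun _ => zero_le)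
    fun n => eLpNorm_comp_le (grad (φ n) - t.2) i

lemma integrable_of_sobolevTests [ENNReal.HolderTriple q p 1] {t : (R3 → ℂ) × (R3 → C3)}
    (h1 : MemLp t.1 q (volume.restrict Ω)) (h2 : MemLp t.2 q (volume.restrict Ω))
    (hF : MemLp F p (volume.restrict Ω)) :
    (∀ k, Integrable (fun x => t.1 x * F x k) (volume.restrict Ω)) ∧
      ∀ i k, Integrable (fun x => t.2 x i * F x k) (volume.restrict Ω) :=
  ⟨fun k => h1.integrable_mul (hF.eval k), fun i k => (h2.eval i).integrable_mul (hF.eval k)⟩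

lemma WeakCurl.sobolevTests [ENNReal.HolderTriple q p 1] (hF : MemLp F p (volume.restrict Ω))
    (hG : MemLp G p (volume.restrict Ω)) (h : WeakCurl (smoothTests Ω) Ω F G) :
    WeakCurl (sobolevTests Ω q) Ω F G := by
  intro t ht
  obtain ⟨φ, hφ, hl1, hl2⟩ := tendsto_sobolevTests (p := p) ht
  have hm := fun n => memLp_of_smoothTests (q := q) (μ := volume.restrict Ω) (hφ n)
  have i1 := integrable_of_sobolevTests ht.1 ht.2.1 hG
  have i2 := integrable_of_sobolevTests ht.1 ht.2.1 hF
  have j1 := fun n => integrable_of_sobolevTests (hm n).1 (hm n).2 hG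
  have j2 := fun n => integrable_of_sobolevTests (hm n).1 (hm n).2 hF
  have lim1 : Tendsto (fun n => ∫ x in Ω, φ n x • G x) atTop (𝓝 (∫ x in Ω, t.1 x • G x)) := by
    refine tendsto_pi_nhds.2 fun k => ?_
    rw [integral_smul_apply i1.1]
    refine (hl1 _ (hG.eval k)).congr fun n => ?_
    rw [integral_smul_apply (j1 n).1]
  have lim2 : Tendsto (fun n => ∫ x in Ω, crossProduct (grad (φ n) x) (F x)) atTop
      (𝓝 (∫ x in Ω, crossProduct (t.2 x) (F x))) := by
    refine tendsto_pi_nhds.2 fun k => ?_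
    rw [integral_cross_apply i2.2]
    have e := fun n => integral_cross_apply (j2 n).2
    have l := fun i k => hl2 i _ (hF.eval k)
    simp only at e
    simp only [e]
    fin_cases k
    · exact (l 1 2).sub (l 2 1)
    · exact (l 2 0).sub (l 0 2)
    · exact (l 0 1).sub (l 1 0)
  refine tendsto_nhds_unique lim1 (lim2.neg.congr fun n => ?_)
  exact (h _ (hφ n)).symm

lemma WeakDiv.sobolevTests [ENNReal.HolderTriple q p 1] {d : R3 → ℂ}
    (hF : MemLp F p (volume.restrict Ω)) (hd : MemLp d p (volume.restrict Ω))
    (h : WeakDiv (smoothTests Ω) Ω F d) : WeakDiv (sobolevTests Ω q) Ω F d := by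
  intro t ht
  obtain ⟨φ, hφ, hl1, hl2⟩ := tendsto_sobolevTests (p := p) ht
  have hm := fun n => memLp_of_smoothTests (q := q) (μ := volume.restrict Ω) (hφ n)
  have i2 := integrable_of_sobolevTests ht.1 ht.2.1 hF
  have j2 := fun n => integrable_of_sobolevTests (hm n).1 (hm n).2 hF
  have lim2 : Tendsto (fun n => ∫ x in Ω, grad (φ n) x ⬝ᵥ F x) atTop
      (𝓝 (∫ x in Ω, t.2 x ⬝ᵥ F x)) := by
    rw [integral_dot_apply i2.2]
    refine (tendsto_finsetSum Finset.univ fun i _ => hl2 i _ (hF.eval i)).congr fun n => ?_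
    exact (integral_dot_apply (j2 n).2).symm
  refine tendsto_nhds_unique (hl1 d hd) (lim2.neg.congr fun n => ?_)
  exact (h _ (hφ n)).symm

/-- For `L^p` fields the Maxwell system tested against smooth functions and against `W₀^{1,q}`
are equivalent. -/
lemma weakMaxwell_sobolevTests_iff [ENNReal.HolderTriple q p 1] {ω ε μ : ℂ} {ρ : R3 → ℂ}
    {j E H : R3 → C3} (hj : MemLp j p (volume.restrict Ω)) (hρ : MemLp ρ p (volume.restrict Ω))
    (hE : MemLp E p (volume.restrict Ω)) (hH : MemLp H p (volume.restrict Ω)) :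
    WeakMaxwell (sobolevTests Ω q) Ω ω ε μ ρ j E H ↔
      WeakMaxwell (smoothTests Ω) Ω ω ε μ ρ j E H := by
  constructor
  · intro h
    have hs := smoothTests_subset_sobolevTests Ω q
    exact ⟨fun t ht => h.curl_H t (hs ht), fun t ht => h.div_H t (hs ht),
      fun t ht => h.curl_E t (hs ht), fun t ht => h.div_E t (hs ht)⟩
  · intro h
    have hρ' : MemLp (fun x => ρ x / ε) p (volume.restrict Ω) := by
      simpa only [div_eq_mul_inv] using hρ.mul_const ε⁻¹
    have h0 : MemLp (fun _ : R3 => (0 : ℂ)) p (volume.restrict Ω) := MemLp.zero'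
    have hE' : MemLp (fun x => -(Complex.I * ω * ε) • E x + j x) p (volume.restrict Ω) :=
      (hE.const_smul (-(Complex.I * ω * ε))).add hj
    have hH' : MemLp (fun x => (Complex.I * ω * μ) • H x) p (volume.restrict Ω) :=
      hH.const_smul (Complex.I * ω * μ)
    exact ⟨WeakCurl.sobolevTests hH hE' h.curl_H, WeakDiv.sobolevTests hH h0 h.div_H,
      WeakCurl.sobolevTests hE hH' h.curl_E, WeakDiv.sobolevTests hE hρ' h.div_E⟩

end Sobolev

/-! ### The representation formula -/

section Representation

variable {Ω : Set R3} {p : ℝ≥0∞} {ω ε μ lam a b : ℂ} {j E H S₁ S₂ : R3 → C3}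

lemma IsCurl.sub {F G F' G' : R3 → C3} (h : IsCurl Ω F G) (h' : IsCurl Ω F' G')
    (hF : LocInt Ω F) (hG : LocInt Ω G) (hF' : LocInt Ω F') (hG' : LocInt Ω G') :
    IsCurl Ω (fun x => F x - F' x) (fun x => G x - G' x) := by
  have := h.add (h'.smul (-1)) hF hG (hF'.smul _) (hG'.smul _)
  simpa only [neg_one_smul, ← sub_eq_add_neg] using this

/-- The divergence equations come from div curl = 0: the E-equation gives iωμ div H = 0, and the
H-equation gives iωε div E = div j, which is div E = ρ/ε. -/
lemma weakMaxwell_smoothTests_iff (hω : ω ≠ 0) (hε : ε ≠ 0) (hμ : μ ≠ 0) {divj ρ : R3 → ℂ}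
    (hρ : ρ = fun x => 1 / (Complex.I * ω) * divj x) (hj : LocInt Ω j)
    (hdiv : WeakDiv (smoothTests Ω) Ω j divj) (hE : LocInt Ω E) (hH : LocInt Ω H) :
    WeakMaxwell (smoothTests Ω) Ω ω ε μ ρ j E H ↔
      IsCurl Ω H (fun x => -(Complex.I * ω * ε) • E x + j x) ∧
      IsCurl Ω E (fun x => (Complex.I * ω * μ) • H x) := by
  have hG1 : LocInt Ω fun x => -(Complex.I * ω * ε) • E x + j x := (hE.smul _).add hj
  constructor
  · intro h
    exact ⟨(weakCurl_iff hH hG1).1 h.curl_H, (weakCurl_iff hE (hH.smul _)).1 h.curl_E⟩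
  · rintro ⟨h1, h2⟩
    refine ⟨(weakCurl_iff hH hG1).2 h1, (weakDiv_iff hH).2 fun φ hφ => ?_,
      (weakCurl_iff hE (hH.smul _)).2 h2, (weakDiv_iff hE).2 fun φ hφ => ?_⟩
    · have h3 := h2.div_eq_zero hφ
      simp only [pair_comp_smul, ← Finset.mul_sum] at h3
      rw [(mul_eq_zero.1 h3).resolve_left (by simp [hω, hμ])]
      simp [pair]
    · have h3 := h1.div_eq_zero hφ
      have h4 := (weakDiv_iff hj).1 hdiv φ hφ
      simp only [pair_comp_add (hφ.pd _) (hE.smul _) hj, pair_comp_smul,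
        Finset.sum_add_distrib, ← Finset.mul_sum] at h3
      have h5 : (fun x => ρ x / ε) = fun x => (1 / (Complex.I * ω * ε)) * divj x := by
        funext x
        rw [hρ]
        field_simp
      rw [h5, pair_const_mul_left, h4]
      have hI := Complex.I_ne_zero
      field_simp
      linear_combination -h3

/-- Maxwell's equations decouple into two inhomogeneous force-free equations. -/
theorem isCurl_pair_iff_representation (hΩ : IsOpen Ω) (hp : 1 ≤ p) (hlam : 0 ≤ lam.im)
    (hlam0 : lam ≠ 0) (ha : a ≠ 0) (hb : b ≠ 0) (hab : a * b = -lam ^ 2)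
    (hj : MemLpLoc j p Ω) (hS₁ : MemLpLoc S₁ p Ω) (hS₂ : MemLpLoc S₂ p Ω)
    (h₁ : IsCurl Ω (fun x => j x - S₁ x) fun x => lam • S₁ x)
    (h₂ : IsCurl Ω (fun x => j x - S₂ x) fun x => (-lam) • S₂ x) :
    (MemLpLoc E p Ω ∧ MemLpLoc H p Ω ∧ IsCurl Ω H (fun x => -a • E x + j x) ∧
      IsCurl Ω E (fun x => b • H x)) ↔
    ∃ u v : R3 → C3, IsForceFree Ω lam u ∧ IsForceFree Ω (-lam) v ∧
      (∀ᵐ x ∂(volume.restrict Ω), E x = (1 / (2 * a)) • ((2 : ℂ) • j x - (S₁ x + S₂ x))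
        + (1 / (2 * a)) • (u x - v x)) ∧
      (∀ᵐ x ∂(volume.restrict Ω), H x = -((1 / (2 * lam)) • (S₁ x - S₂ x))
        + (1 / (2 * lam)) • (u x + v x)) := by
  have lj := hj.locInt hp hΩ
  have l1 := hS₁.locInt hp hΩ
  have l2 := hS₂.locInt hp hΩ
  have ljS1 := lj.sub l1
  have ljS2 := lj.sub l2
  constructor
  · rintro ⟨hE, hH, hcH, hcE⟩
    have lE := hE.locInt hp hΩ
    have lH := hH.locInt hp hΩ
    have lG : LocInt Ω fun x => -a • E x + j x := (lE.smul _).add lj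
    have hlE := hcE.smul a
    have hlH := hcH.smul lam
    -- The field aE + λH minus its particular solution. Its curl is abH + λ(j - aE) - λS₁, which is
    -- -λ times the field because ab = -λ².
    obtain ⟨u, hu, hwu⟩ := exists_isForceFree (κ := lam) hΩ hlam rfl hlam0
      (w := fun x => (a • E x + lam • H x) - (j x - S₁ x))
      (((lE.smul a).add (lH.smul lam)).sub ljS1) (by
        have h := (hlE.add hlH (lE.smul _) ((lH.smul _).smul _) (lH.smul _) (lG.smul _)).sub h₁
          ((lE.smul _).add (lH.smul _)) (((lH.smul _).smul _).add (lG.smul _)) ljS1 (l1.smul _)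
        convert h using 2 with x
        have : a • b • H x = (-lam ^ 2) • H x := by rw [smul_smul, hab]
        rw [this]
        module)
    -- Since j - S₂ solves (curl - λ)w = -λj while λH - aE has right-hand side +λj, the particular
    -- solution is added here.
    obtain ⟨v, hv, hwv⟩ := exists_isForceFree (κ := -lam) hΩ hlam (neg_sq lam)
      (neg_ne_zero.2 hlam0) (w := fun x => (lam • H x - a • E x) + (j x - S₂ x))
      (((lH.smul lam).sub (lE.smul a)).add ljS2) (by
        have h := (hlH.sub hlE (lH.smul _) (lG.smul _) (lE.smul _) ((lH.smul _).smul _)).add h₂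
          ((lH.smul _).sub (lE.smul _)) ((lG.smul _).sub ((lH.smul _).smul _)) ljS2 (l2.smul _)
        convert h using 2 with x
        have : a • b • H x = (-lam ^ 2) • H x := by rw [smul_smul, hab]
        rw [this]
        module)
    refine ⟨u, v, hu, hv, ?_, ?_⟩
    · filter_upwards [hwu, hwv] with x hxu hxv
      rw [← hxu, ← hxv]
      funext i
      simp only [Pi.add_apply, Pi.sub_apply, Pi.smul_apply, smul_eq_mul]
      field_simp
      ring
    · filter_upwards [hwu, hwv] with x hxu hxv
      rw [← hxu, ← hxv]
      funext i
      simp only [Pi.add_apply, Pi.sub_apply, Pi.smul_apply, Pi.neg_apply, smul_eq_mul]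
      field_simp
      ring
  · rintro ⟨u, v, hu, hv, hE, hH⟩
    have mu : MemLpLoc u p Ω := memLpLoc_of_continuousOn hu.contDiffOn.continuousOn
    have mv : MemLpLoc v p Ω := memLpLoc_of_continuousOn hv.contDiffOn.continuousOn
    have lu := mu.locInt hp hΩ
    have lv := mv.locInt hp hΩ
    have cu := hu.isCurl hΩ
    have cv := hv.isCurl hΩ
    -- The representation is regrouped through j - S₁ and j - S₂, whose curls are known, so that the
    -- curl can be taken by linearity.
    have hE' : (fun x => (1 / (2 * a)) • ((j x - S₁ x) + (j x - S₂ x) + (u x - v x)))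
        =ᵐ[volume.restrict Ω] E := by
      filter_upwards [hE] with x hx
      rw [hx]
      module
    have hH' : (fun x => (1 / (2 * lam)) • ((j x - S₁ x) - (j x - S₂ x) + (u x + v x)))
        =ᵐ[volume.restrict Ω] H := by
      filter_upwards [hH] with x hx
      rw [hx]
      module
    have cE := ((h₁.add h₂ ljS1 (l1.smul _) ljS2 (l2.smul _)).add
      (cu.sub cv lu (lu.smul _) lv (lv.smul _)) (ljS1.add ljS2) ((l1.smul _).add (l2.smul _))
      (lu.sub lv) ((lu.smul _).sub (lv.smul _))).smul (1 / (2 * a))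
    have cH := ((h₁.sub h₂ ljS1 (l1.smul _) ljS2 (l2.smul _)).add
      (cu.add cv lu (lu.smul _) lv (lv.smul _)) (ljS1.sub ljS2) ((l1.smul _).sub (l2.smul _))
      (lu.add lv) ((lu.smul _).add (lv.smul _))).smul (1 / (2 * lam))
    refine ⟨MemLpLoc.congr_ae ((((hj.sub hS₁).add (hj.sub hS₂)).add (mu.sub mv)).smul _) hE',
      MemLpLoc.congr_ae ((((hj.sub hS₁).sub (hj.sub hS₂)).add (mu.add mv)).smul _) hH',
      cH.congr_ae hH' ?_, cE.congr_ae hE' ?_⟩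
    · filter_upwards [hE'] with x hx
      rw [← hx]
      funext i
      simp only [Pi.add_apply, Pi.sub_apply, Pi.smul_apply, smul_eq_mul]
      field_simp
      ring
    · filter_upwards [hH'] with x hx
      rw [← hx]
      have hb' : b = -lam ^ 2 / a := by
        rw [← hab]
        field_simp
      funext i
      simp only [Pi.add_apply, Pi.sub_apply, Pi.smul_apply, smul_eq_mul, hb']
      field_simp
      ring

end Representation

end MaxwellWeak

end

/-! ### Assembly of the main theorem -/

theorem mainTheorem4
    (Ω : Set MaxwellWeak.R3) (hΩ : MaxwellWeak.IsLiapunovDomain Ω)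
    (p q : ℝ≥0∞) (hp : 1 < p) (hp_top : p < ⊤) (hpq : 1 / p + 1 / q = 1)
    (ω ε μ lam : ℂ) (hω : ω ≠ 0) (hε : ε ≠ 0) (hμ : μ ≠ 0)
    (hlam : lam ^ 2 = ω ^ 2 * (ε * μ)) (hlam_im : 0 ≤ lam.im)
    (j : MaxwellWeak.R3 → MaxwellWeak.C3) (divj : MaxwellWeak.R3 → ℂ)
    (hj : MaxwellWeak.MemWDiv Ω p j divj)
    (ρ : MaxwellWeak.R3 → ℂ) (hρ : ρ = fun x => 1 / (Complex.I * ω) * divj x) :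
    (∀ κ ∈ ({lam, -lam} : Set ℂ), ∀ᵐ x ∂(volume.restrict Ω),
      IntegrableOn (MaxwellWeak.teodorescuIntegrand lam κ j x) Ω) ∧
    ∃ S Δ : MaxwellWeak.R3 → MaxwellWeak.C3,
      MaxwellWeak.MemLpLoc (MaxwellWeak.teodorescuTwo Ω lam lam j) p Ω ∧
      MaxwellWeak.MemLpLoc (MaxwellWeak.teodorescuTwo Ω lam (-lam) j) p Ω ∧
      MaxwellWeak.MemLpLoc S p Ω ∧ MaxwellWeak.MemLpLoc Δ p Ω ∧
      MaxwellWeak.WeakCurl (MaxwellWeak.smoothTests Ω) Ω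
        (MaxwellWeak.teodorescuTwo Ω lam lam j + MaxwellWeak.teodorescuTwo Ω lam (-lam) j) S ∧
      MaxwellWeak.WeakCurl (MaxwellWeak.smoothTests Ω) Ω
        (MaxwellWeak.teodorescuTwo Ω lam lam j - MaxwellWeak.teodorescuTwo Ω lam (-lam) j) Δ ∧
      (∀ E H : MaxwellWeak.R3 → MaxwellWeak.C3,
        (MaxwellWeak.MemLpLoc E p Ω ∧ MaxwellWeak.MemLpLoc H p Ω ∧
          MaxwellWeak.WeakMaxwell (MaxwellWeak.smoothTests Ω) Ω ω ε μ ρ j E H) ↔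
        MaxwellWeak.HasRepresentation Ω ω ε lam j S Δ E H) ∧
      (∀ E H : MaxwellWeak.R3 → MaxwellWeak.C3,
        MemLp E p (volume.restrict Ω) → MemLp H p (volume.restrict Ω) →
        (MaxwellWeak.WeakMaxwell (MaxwellWeak.sobolevTests Ω q) Ω ω ε μ ρ j E H ↔
          MaxwellWeak.HasRepresentation Ω ω ε lam j S Δ E H)) := by
  have hΩo := hΩ.isOpen
  have hlam0 : lam ≠ 0 := by
    rintro rfl
    have : ω ^ 2 * (ε * μ) ≠ 0 := mul_ne_zero (pow_ne_zero 2 hω) (mul_ne_zero hε hμ)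
    exact this (by rw [← hlam]; simp)
  have hI := Complex.I_ne_zero
  have hqp : ENNReal.HolderTriple q p 1 := ⟨by
    rw [inv_one, add_comm, ← one_div, ← one_div, hpq]⟩
  obtain ⟨S, hS⟩ := MaxwellWeak.exists_curl_teodorescu hΩo hΩ.isBounded hp hp_top hlam_im hj
  obtain ⟨i₁, t₁, s₁, c₁, d₁⟩ := hS lam rfl
  obtain ⟨i₂, t₂, s₂, c₂, d₂⟩ := hS (-lam) (neg_sq lam)
  have lt₁ := t₁.locInt hp.le hΩo
  have lt₂ := t₂.locInt hp.le hΩo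
  have ls₁ := s₁.locInt hp.le hΩo
  have ls₂ := s₂.locInt hp.le hΩo
  have hjloc : MaxwellWeak.MemLpLoc j p Ω := MaxwellWeak.memLpLoc_of_memLp hj.1
  have hjl := hjloc.locInt hp.le hΩo
  have hρp : MemLp ρ p (volume.restrict Ω) := by
    rw [hρ]
    exact hj.2.1.const_mul _
  have hpart : ∀ E H : MaxwellWeak.R3 → MaxwellWeak.C3,
      (MaxwellWeak.MemLpLoc E p Ω ∧ MaxwellWeak.MemLpLoc H p Ω ∧
        MaxwellWeak.WeakMaxwell (MaxwellWeak.smoothTests Ω) Ω ω ε μ ρ j E H) ↔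
      MaxwellWeak.HasRepresentation Ω ω ε lam j (fun x => S lam x + S (-lam) x)
        (fun x => S lam x - S (-lam) x) E H := by
    intro E H
    -- The hypothesis on ab holds because (iωε)(iωμ) = -ω²εμ = -λ².
    have h := MaxwellWeak.isCurl_pair_iff_representation (E := E) (H := H)
      (a := Complex.I * ω * ε) (b := Complex.I * ω * μ) hΩo hp.le hlam_im hlam0
      (by simp [hω, hε]) (by simp [hω, hμ])
      (by rw [hlam]; linear_combination ω ^ 2 * ε * μ * Complex.I_sq) hjloc s₁ s₂ d₁ d₂
    rw [MaxwellWeak.HasRepresentation]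
    simp only [mul_assoc] at h ⊢
    rw [← h]
    refine and_congr_right fun hE => and_congr_right fun hH => ?_
    have h2 := MaxwellWeak.weakMaxwell_smoothTests_iff hω hε hμ hρ hjl hj.2.2
      (hE.locInt hp.le hΩo) (hH.locInt hp.le hΩo)
    simp only [mul_assoc] at h2
    exact h2
  refine ⟨?_, fun x => S lam x + S (-lam) x, fun x => S lam x - S (-lam) x, t₁, t₂, s₁.add s₂,
    s₁.sub s₂, (MaxwellWeak.weakCurl_iff (lt₁.add lt₂) (ls₁.add ls₂)).2 (c₁.add c₂ lt₁ ls₁ lt₂ ls₂),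
    (MaxwellWeak.weakCurl_iff (lt₁.sub lt₂) (ls₁.sub ls₂)).2 (c₁.sub c₂ lt₁ ls₁ lt₂ ls₂), hpart,
    fun E H hE hH => ?_⟩
  · rintro κ (rfl | rfl)
    exacts [i₁, i₂]
  -- For fields in L^p the Sobolev tests reduce to smooth ones, and the local statement already
  -- proved applies.
  · rw [MaxwellWeak.weakMaxwell_sobolevTests_iff hj.1 hρp hE hH, ← hpart E H]
    exact ⟨fun h => ⟨MaxwellWeak.memLpLoc_of_memLp hE, MaxwellWeak.memLpLoc_of_memLp hH, h⟩,
      fun h => h.2.2⟩
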